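/- **Setting.** Let $n\in\mathbb N$, let $X\subseteq\mathbb R^n$ be a closed convex set with Euclidean projection $\Pi_X$, and let $(\gamma_k)_{k\ge0},(\eta_k)_{k\ge0}$ be positive sequences with $$\sum_k\gamma_k=\infty,\qquad \sum_k\gamma_k^2<\infty,\qquad \sum_k\gamma_k\eta_k<\infty .$$ For an integrand $H(x,s)$, $x\in\mathbb R^n$, the *exponentially-shifted Gaussian smoothing (esGs) estimator* $\tilde g_\eta(x,v,z,s)\in\mathbb R^n$ has the components $$\tilde g^i_\eta(x,v,z,s)=\frac1{\eta\sqrt{2\pi}}\Big[H\big(x_i+\eta\sqrt{2v},\,x^{-i}-z^{-i},\,s\big)-H\big(x_i-\eta\sqrt{2v},\,x^{-i}-z^{-i},\,s\big)\Big],\quad i=1,\dots,n,$$ where $(x_i+t,\,x^{-i}-z^{-i})$ denotes the point with $i$-th coordinate $x_i+t$ and $j$-th coordinate $x_j-z_j$ for $j\ne i$. The projected zeroth-order SGD iterates are $$x_{k+1}=\Pi_X\big[x_k-\gamma_k\,\tilde g_{\eta_k}(x_k,V_k,Z_k,s_k)\big],\qquad k\ge0,$$ where $x_0\in X$ is a deterministic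 or random point, $V_k\sim\mathrm{Exp}(1)$, $Z_k\sim\mathcal N_n(0,\eta_k^2I)$, the samples $s_k$ are identically distributed with a law $P$, and $x_0$ and all $V_k,Z_k,s_k$ $(k\ge 0)$ are mutually independent. Consider $\min_{x\in X}f(x)$, with set of optimal solutions $X^*=\{x\in X: f(x)\le f(y)\ \forall y\in X\}$, in each of the following three settings. 1. *Standard.* $f(x)=\mathbb E_{\xi\sim P}[F(x,\xi)]$, where $F(x,\cdot)$ is measurable and $P$-integrable for every $x$; $F(\cdot,\xi)$ is convex on $\mathbb R^n$ for every $\xi$; and for some $L_0$, $\|F(x,\cdot)-F(y,\cdot)\|_{L^2(P)}\le L_0\|x-y\|$ for all $x,y\in\mathbb R^n$. Here $H=F$ and the samples are $s_k=\xi_k\sim P$. 2. *Decision-dependent, known density.* $f(x)=\mathbb E_{\xi\sim\mathcal D(x)}[\hat F(x,\xi)]=\int_{\Xi(x)}\hat F(x,\xi)\,p(\xi\mid x)\,d\xi$, where $\mathcal D(x)$ has density $p(\cdot\mid x)$ with respect to a fixed $\sigma$-finite measure (such as Lebesgue measure), positive on $\Xi(x)$ and zero off $\Xi(x)$; $\hat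 F$ and $p$ are jointly measurable; $f$ is convex on $\mathbb R^n$; and $\tilde p$ is a probability density that is positive on every $\Xi(x)$. There are constants $L_\xi,M,\hat L_f,M_f$ such that for all $x,y\in\mathbb R^n$: $D_{\rm KL}(\mathcal D(x)\|\mathcal D(y))+D_{\rm KL}(\mathcal D(y)\|\mathcal D(x))\le L_\xi^2\|x-y\|^2$; $p(\xi\mid x)/\tilde p(\xi)\le M$ for all $\xi\in\Xi(x)$; $\|\hat F(x,\cdot)-\hat F(y,\cdot)\|_{L^2(\tilde p)}\le\hat L_f\|x-y\|$; and $|\hat F(x,\xi)|\le M_f$ for almost every $\xi\in\Xi(x)$. Here $H(x,\xi)=\hat F(x,\xi)\,p(\xi\mid x)/\tilde p(\xi)$ (zero where $\tilde p(\xi)=0$), and the samples $s_k=\xi_k$ have density $\tilde p$. 3. *Decision-dependent, unknown distribution.* $f(x)=\mathbb E_{\xi\sim\mathcal D(x)}[\hat F(x,\xi)]$ is convex on $\mathbb R^n$, where $\hat F$ is jointly measurable and $\hat F(x,\cdot)$ is $\mathcal D(x)$-integrable for every $x$. There is a jointly measurable random field $\boldsymbol\xi=(\boldsymbol\xi_x)_{x\in\mathbb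 R^n}$, $\boldsymbol\xi_x=\boldsymbol\xi_x(s)$, on a probability space with law $P$, such that $\boldsymbol\xi_x\sim\mathcal D(x)$ for every $x$ and, for some $L_0$, $\big(\mathbb E|\hat F(x,\boldsymbol\xi_x)-\hat F(y,\boldsymbol\xi_y)|^2\big)^{1/2}\le L_0\|x-y\|$ for all $x,y\in\mathbb R^n$. At iteration $k$ the oracle draws a scenario $s_k\sim P$, that is, an independent copy of the field, and answers queries at points $y$ with $\hat F(y,\boldsymbol\xi_y(s_k))$; thus $H(y,s)=\hat F(y,\boldsymbol\xi_y(s))$. **Proposition 4.1.** In each of the three settings, if $X^*\neq\emptyset$, then almost surely the sequence $(x_k)$ converges to some point $x^*\in X^*$ (which may depend on the outcome). -/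

import Mathlib

open MeasureTheory ProbabilityTheory Filter Topology

noncomputable section

namespace EsGs

/-- The point `(x_i + t, x^{-i} - z^{-i})`: coordinate `i` is shifted by `t`, every other
coordinate `j` is shifted by `-z_j`. -/
def shiftPoint {n : ℕ} (x : EuclideanSpace ℝ (Fin n)) (i : Fin n) (t : ℝ)
    (z : EuclideanSpace ℝ (Fin n)) : EuclideanSpace ℝ (Fin n) :=
  WithLp.toLp 2 (fun j => if j = i then x j + t else x j - z j)

/-- The exponentially-shifted Gaussian smoothing gradient estimator with smoothing parameter `η`
for the integrand `H`, evaluated at `x` with the samples `v`, `z`, `s`. Its `i`-th component is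
`(H (x_i + η √(2v), x^{-i} - z^{-i}, s) - H (x_i - η √(2v), x^{-i} - z^{-i}, s)) / (η √(2π))`. -/
def estimator {n : ℕ} {S : Type*} (H : EuclideanSpace ℝ (Fin n) → S → ℝ) (η : ℝ)
    (x : EuclideanSpace ℝ (Fin n)) (v : ℝ) (z : EuclideanSpace ℝ (Fin n)) (s : S) :
    EuclideanSpace ℝ (Fin n) :=
  WithLp.toLp 2 (fun i => 1 / (η * √(2 * Real.pi)) *
    (H (shiftPoint x i (η * √(2 * v)) z) s - H (shiftPoint x i (-(η * √(2 * v))) z) s))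

/-- `p` is the Euclidean projection of `u` onto `X`: a nearest point of `X` to `u`
(it exists and is unique when `X` is nonempty, closed and convex). -/
def IsProjection {n : ℕ} (X : Set (EuclideanSpace ℝ (Fin n)))
    (u p : EuclideanSpace ℝ (Fin n)) : Prop :=
  p ∈ X ∧ ∀ y ∈ X, ‖u - p‖ ≤ ‖u - y‖

/-- The set of optimal solutions of `min_{x ∈ X} f x`. -/
def optimalSet {n : ℕ} (X : Set (EuclideanSpace ℝ (Fin n)))
    (f : EuclideanSpace ℝ (Fin n) → ℝ) : Set (EuclideanSpace ℝ (Fin n)) :=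
  {x | x ∈ X ∧ ∀ y ∈ X, f x ≤ f y}

/-- The conditions on the step lengths `γ` and the smoothing parameters `η`. -/
structure StepAssumption (γ η : ℕ → ℝ) : Prop where
  γ_pos : ∀ k, 0 < γ k
  η_pos : ∀ k, 0 < η k
  sum_γ : Tendsto (fun N => ∑ k ∈ Finset.range N, γ k) atTop atTop
  sum_γ_sq : Summable (fun k => γ k ^ 2)
  sum_γ_η : Summable (fun k => γ k * η k)

/-- The sequence `x` is generated by the projected zeroth-order stochastic gradient scheme
`x_{k+1} = Π_X [x_k - γ_k g_{η_k}(x_k, V_k, Z_k, s_k)]`, where `g_η` is the estimator for the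
integrand `H`, started from a (possibly random) point `x_0` of `X`. Here `V_k ∼ Exp(1)`,
`Z_k ∼ N(0, η_k² I)` and `s_k ∼ P`; all the samples are mutually independent and independent
of `x_0`. -/
structure IsZOSGD {n : ℕ} {Ω S : Type*} [MeasurableSpace Ω] [MeasurableSpace S]
    (μ : Measure Ω) (P : Measure S) (H : EuclideanSpace ℝ (Fin n) → S → ℝ)
    (X : Set (EuclideanSpace ℝ (Fin n))) (γ η : ℕ → ℝ) (V : ℕ → Ω → ℝ)
    (Z : ℕ → Ω → EuclideanSpace ℝ (Fin n)) (s : ℕ → Ω → S)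
    (x : ℕ → Ω → EuclideanSpace ℝ (Fin n)) : Prop where
  measurable_V : ∀ k, Measurable (V k)
  measurable_Z : ∀ k, Measurable (Z k)
  measurable_s : ∀ k, Measurable (s k)
  measurable_init : Measurable (x 0)
  /-- Within an iteration the three samples are independent and have the stated laws. -/
  law_sample : ∀ k, μ.map (fun ω => (V k ω, Z k ω, s k ω)) =
    (expMeasure 1).prod ((multivariateGaussian 0 (η k ^ 2 • 1)).prod P)
  /-- The samples of different iterations are independent. -/
  indep_sample : iIndepFun (fun k ω => (V k ω, Z k ω, s k ω)) μ
  indep_init : IndepFun (x 0) (fun ω k => (V k ω, Z k ω, s k ω)) μ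
  init_mem : ∀ ω, x 0 ω ∈ X
  step : ∀ k ω, IsProjection X
    (x k ω - γ k • estimator H (η k) (x k ω) (V k ω) (Z k ω) (s k ω)) (x (k + 1) ω)

/-- The random sequence `x` converges almost surely to some point of `A`, which may depend on
the outcome. -/
def ConvergesAS {n : ℕ} {Ω : Type*} [MeasurableSpace Ω] (μ : Measure Ω)
    (x : ℕ → Ω → EuclideanSpace ℝ (Fin n)) (A : Set (EuclideanSpace ℝ (Fin n))) : Prop :=
  ∀ᵐ ω ∂μ, ∃ xstar ∈ A, Tendsto (fun k => x k ω) atTop (𝓝 xstar)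

/-! ### The standard (decision-independent) setting -/

/-- The objective `f x = 𝔼_{ξ ∼ P} [F (x, ξ)]`. -/
def objective {n : ℕ} {Ξ : Type*} [MeasurableSpace Ξ] (P : Measure Ξ)
    (F : EuclideanSpace ℝ (Fin n) → Ξ → ℝ) (x : EuclideanSpace ℝ (Fin n)) : ℝ :=
  ∫ ξ, F x ξ ∂P

/-- The assumptions in the standard setting: the expectation defining the objective exists,
`F` is `L₀`-Lipschitz in the `L²(ξ)` norm, and `F (·, ξ)` is convex for every `ξ`. -/
structure StandardAssumption {n : ℕ} {Ξ : Type*} [MeasurableSpace Ξ] (P : Measure Ξ)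
    (F : EuclideanSpace ℝ (Fin n) → Ξ → ℝ) (L₀ : ℝ) : Prop where
  measurable : ∀ x, Measurable (F x)
  integrable : ∀ x, Integrable (F x) P
  lipschitz : ∀ x y, eLpNorm (fun ξ => F x ξ - F y ξ) 2 P ≤ ENNReal.ofReal (L₀ * ‖x - y‖)
  convex : ∀ ξ, ConvexOn ℝ Set.univ (fun x => F x ξ)

/-! ### The decision-dependent settings -/

/-- The decision-dependent objective `f x = 𝔼_{ξ ∼ D(x)} [Fhat (x, ξ)]`. -/
def ddObjective {n : ℕ} {Ξ : Type*} [MeasurableSpace Ξ]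
    (D : EuclideanSpace ℝ (Fin n) → Measure Ξ)
    (Fhat : EuclideanSpace ℝ (Fin n) → Ξ → ℝ) (x : EuclideanSpace ℝ (Fin n)) : ℝ :=
  ∫ ξ, Fhat x ξ ∂(D x)

/-- `q` is a probability density with respect to `ν`. -/
structure IsDensity {Ξ : Type*} [MeasurableSpace Ξ] (ν : Measure Ξ) (q : Ξ → ℝ) : Prop where
  measurable : Measurable q
  nonneg : ∀ ξ, 0 ≤ q ξ
  integral_eq_one : ∫⁻ ξ, ENNReal.ofReal (q ξ) ∂ν = 1

/-- The distribution with density `q` with respect to `ν`. -/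
def densityLaw {Ξ : Type*} [MeasurableSpace Ξ] (ν : Measure Ξ) (q : Ξ → ℝ) : Measure Ξ :=
  ν.withDensity (fun ξ => ENNReal.ofReal (q ξ))

/-- The symmetric Kullback-Leibler divergence (infinite unless the two laws are mutually
absolutely continuous). -/
def symKL {Ξ : Type*} [MeasurableSpace Ξ] (P Q : Measure Ξ) : ENNReal :=
  InformationTheory.klDiv P Q + InformationTheory.klDiv Q P

/-- The reweighted integrand `Fhat (x, ξ) p(ξ | x) / pt ξ`, where `p x ξ` is `p(ξ | x)`. -/
def reweighted {n : ℕ} {Ξ : Type*} (Fhat p : EuclideanSpace ℝ (Fin n) → Ξ → ℝ) (pt : Ξ → ℝ)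
    (x : EuclideanSpace ℝ (Fin n)) (ξ : Ξ) : ℝ :=
  Fhat x ξ * (p x ξ / pt ξ)

/-- The assumptions in the decision-dependent setting with a known conditional density
`p x ξ = p(ξ | x)` of `D(x)`, supported on `supp x = Ξ(x)`, and a sampling density `pt`
which is positive on every `Ξ(x)`. -/
structure KnownDensityAssumption {n : ℕ} {Ξ : Type*} [MeasurableSpace Ξ] (ν : Measure Ξ)
    (supp : EuclideanSpace ℝ (Fin n) → Set Ξ) (Fhat p : EuclideanSpace ℝ (Fin n) → Ξ → ℝ)
    (pt : Ξ → ℝ) (Lξ M Lf Mf : ℝ) : Prop where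
  measurable_Fhat : Measurable (Function.uncurry Fhat)
  measurable_p : Measurable (Function.uncurry p)
  density_p : ∀ x, IsDensity ν (p x)
  density_pt : IsDensity ν pt
  p_pos : ∀ x, ∀ ξ ∈ supp x, 0 < p x ξ
  p_zero : ∀ x, ∀ ξ ∉ supp x, p x ξ = 0
  pt_pos : ∀ x, ∀ ξ ∈ supp x, 0 < pt ξ
  symKL_le : ∀ x y, symKL (densityLaw ν (p x)) (densityLaw ν (p y)) ≤
    ENNReal.ofReal (Lξ ^ 2 * ‖x - y‖ ^ 2)
  ratio_le : ∀ x, ∀ ξ ∈ supp x, p x ξ / pt ξ ≤ M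
  lipschitz : ∀ x y, eLpNorm (fun ξ => Fhat x ξ - Fhat y ξ) 2 (densityLaw ν pt) ≤
    ENNReal.ofReal (Lf * ‖x - y‖)
  bounded : ∀ x, ∀ᵐ ξ ∂ν, ξ ∈ supp x → |Fhat x ξ| ≤ Mf
  convex : ConvexOn ℝ Set.univ (ddObjective (fun x => densityLaw ν (p x)) Fhat)

/-- The assumptions in the decision-dependent setting with an unknown distribution. The oracle
draws a scenario `s ∼ P` and answers with the random field `x ↦ field x s`, whose marginal at `x`
is `D x`; the field correlates the answers at different points in such a way that
`x ↦ Fhat (x, ξ_x)` is `L₀`-Lipschitz in `L²`. -/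
structure RandomFieldAssumption {n : ℕ} {Ξ S : Type*} [MeasurableSpace Ξ] [MeasurableSpace S]
    (P : Measure S) (field : EuclideanSpace ℝ (Fin n) → S → Ξ)
    (D : EuclideanSpace ℝ (Fin n) → Measure Ξ)
    (Fhat : EuclideanSpace ℝ (Fin n) → Ξ → ℝ) (L₀ : ℝ) : Prop where
  measurable_Fhat : Measurable (Function.uncurry Fhat)
  measurable_field : Measurable (Function.uncurry field)
  marginal : ∀ x, P.map (field x) = D x
  integrable : ∀ x, Integrable (Fhat x) (D x)
  lipschitz : ∀ x y, eLpNorm (fun s => Fhat x (field x s) - Fhat y (field y s)) 2 P ≤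
    ENNReal.ofReal (L₀ * ‖x - y‖)
  convex : ConvexOn ℝ Set.univ (ddObjective D Fhat)

end EsGs

end

/-!
All three settings supply the same data: a jointly measurable integrand `H` that is Lipschitz in
`L²(P)` and whose mean is the convex objective `f` (`LipschitzIntegrand`). For such an integrand the
convergence is proved in `IsZOSGD.convergesAS` by a Robbins-Siegmund argument.

*Bias.* For a Lipschitz function `g` on the line, `g a - g (-a)` is the integral of `g'` over
`(-a, a)`. With `a = η √(2v)` and `v ∼ Exp(1)`, the point `t` lies in this interval with probability
`exp (-t² / (2η²))`, so the expected symmetric difference is, up to the factor `η √(2π)`, the mean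
of `g'` under `N(0, η²)` (`integral_exp_shift`). Hence the estimator has as its mean the vector of
partial derivatives of `f` averaged over `N(0, η² I)`. By Rademacher's theorem and convexity this
vector is a subgradient at `x` of the Gaussian smoothing of `f` (`smoothing_subgradient`), which
differs from `f` by `O(η)`.

*Variance.* The two query points are at distance `2η √(2v)`, so the second moment of the estimator
is bounded independently of `η` (`LipschitzIntegrand.lintegral_estimator_sq_le`).

*Descent.* For `y` optimal, these facts and the nonexpansiveness of the projection give
`𝔼[‖x (k+1) - y‖² | ℱ k] + 2 γ k (f (x k) - f y) ≤ ‖x k - y‖² + O(γ k η k + γ k²)`. By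
`almost_supermartingale`, almost surely `‖x k - y‖` converges and `∑ γ k (f (x k) - f y) < ∞`. As
`∑ γ k = ∞`, some subsequence of the iterates converges to an optimal solution `p`; applying the
above to all `y` in a countable dense set of optimal solutions shows that the whole sequence
converges to `p` (`exists_tendsto_optimalSet`).

In the known density setting the `L²` Lipschitz property of the reweighted integrand needs the
likelihood ratios `p (ξ | x) / pt ξ` to be Lipschitz in `L²`. They are bounded by `M`, and on a
bounded range the symmetrized Kullback-Leibler integrand `(a - b) (log a - log b)` dominates a
multiple of `(a - b)²` (`lintegral_ratio_sub_sq_le`).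
-/

namespace EsGs

/-! ### The exponential shift in dimension one -/

instance isProbabilityMeasure_exp : IsProbabilityMeasure (expMeasure 1) :=
  isProbabilityMeasure_expMeasure one_pos

lemma expMeasure_Ioi {a : ℝ} (ha : 0 ≤ a) :
    expMeasure 1 (Set.Ioi a) = ENNReal.ofReal (Real.exp (-a)) := by
  rw [← Set.compl_Iic, prob_compl_eq_one_sub measurableSet_Iic, ← ofReal_cdf,
    cdf_expMeasure_eq one_pos, if_pos ha, one_mul, ← ENNReal.ofReal_one,
    ← ENNReal.ofReal_sub _ (by simpa using ha)]
  congr 1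
  ring

lemma ae_exp_nonneg : ∀ᵐ v ∂(expMeasure 1), 0 ≤ v := by
  have h := expMeasure_Ioi le_rfl
  rw [neg_zero, Real.exp_zero, ENNReal.ofReal_one] at h
  filter_upwards [(prob_compl_eq_zero_iff measurableSet_Ioi).2 h] with v hv using
    le_of_lt (by simpa using hv)

lemma lintegral_id_expMeasure : ∫⁻ v, ENNReal.ofReal v ∂(expMeasure 1) = 1 := by
  rw [lintegral_eq_lintegral_meas_lt _ ae_exp_nonneg (by fun_prop)]
  have h : ∀ t ∈ Set.Ioi (0 : ℝ), expMeasure 1 {a | t < a} = ENNReal.ofReal (Real.exp (-t)) :=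
    fun t ht => expMeasure_Ioi (le_of_lt ht)
  rw [setLIntegral_congr_fun measurableSet_Ioi h,
    ← ofReal_integral_eq_lintegral_ofReal (integrableOn_exp_neg_Ioi 0)
      (Eventually.of_forall fun _ => (Real.exp_pos _).le), integral_exp_neg_Ioi_zero,
    ENNReal.ofReal_one]

/-- This holds for negative `v` too: both sides are then false, as `√(2 * v) = 0`. -/
lemma abs_lt_shift_iff {η : ℝ} (hη : 0 < η) (t v : ℝ) :
    |t| < η * √(2 * v) ↔ t ^ 2 / (2 * η ^ 2) < v := by
  rw [← div_lt_iff₀' hη, Real.lt_sqrt (by positivity), div_pow, sq_abs, div_lt_iff₀ (by positivity),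
    div_lt_iff₀ (by positivity)]
  constructor <;> intro h <;> linarith

/-- The exponential shift turns symmetric differences into averaged derivatives: writing
`g a - g (-a)` as the integral of `g'` over `(-a, a)`, the point `t` is covered with probability
`P (t² / (2η²) < v) = exp (-t² / (2η²))`, which is the Gaussian density up to normalization. -/
lemma integral_exp_shift {g : ℝ → ℝ} {L : NNReal} (hg : LipschitzWith L g) {η : ℝ} (hη : 0 < η) :
    ∫ v, (g (η * √(2 * v)) - g (-(η * √(2 * v)))) ∂(expMeasure 1) =
      ∫ t, deriv g t * Real.exp (-(t ^ 2 / (2 * η ^ 2))) := by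
  set A : Set (ℝ × ℝ) := {q | |q.2| < η * √(2 * q.1)} with hA
  have hAm : MeasurableSet A := measurableSet_lt (by fun_prop) (by fun_prop)
  have hgm : Measurable (deriv g) := measurable_deriv g
  have hexp : Integrable (fun t : ℝ => Real.exp (-(t ^ 2 / (2 * η ^ 2)))) := by
    refine (integrable_exp_neg_mul_sq (b := 1 / (2 * η ^ 2)) (by positivity)).congr
      (Eventually.of_forall fun t => ?_)
    simp only
    congr 1
    ring
  have hsec : ∀ t : ℝ, (fun v => A.indicator (fun q => deriv g q.2) (v, t)) =
      (Set.Ioi (t ^ 2 / (2 * η ^ 2))).indicator (fun _ => deriv g t) := by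
    intro t
    ext v
    simp only [Set.indicator, hA, Set.mem_ofPred_eq, abs_lt_shift_iff hη, Set.mem_Ioi]
  have hreal : ∀ t : ℝ, (expMeasure 1).real (Set.Ioi (t ^ 2 / (2 * η ^ 2))) =
      Real.exp (-(t ^ 2 / (2 * η ^ 2))) := fun t => by
    rw [measureReal_def, expMeasure_Ioi (by positivity), ENNReal.toReal_ofReal (Real.exp_pos _).le]
  have hint : Integrable (fun q : ℝ × ℝ => A.indicator (fun q => deriv g q.2) q)
      ((expMeasure 1).prod volume) := by
    have hms : AEStronglyMeasurable (fun q : ℝ × ℝ => A.indicator (fun q => deriv g q.2) q)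
      ((expMeasure 1).prod volume) :=
      ((hgm.comp measurable_snd).indicator hAm).aestronglyMeasurable
    rw [integrable_prod_iff' hms]
    refine ⟨Eventually.of_forall fun t => ?_, ?_⟩
    · rw [hsec]
      exact (integrable_const _).indicator measurableSet_Ioi
    · refine (hexp.const_mul (L : ℝ)).mono' hms.norm.prod_swap.integral_prod_right' ?_
      refine Eventually.of_forall fun t => ?_
      rw [Real.norm_of_nonneg (integral_nonneg fun _ => norm_nonneg _)]
      have : (fun v => ‖A.indicator (fun q => deriv g q.2) (v, t)‖) =
          (Set.Ioi (t ^ 2 / (2 * η ^ 2))).indicator (fun _ => ‖deriv g t‖) := by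
        ext v
        rw [congrFun (hsec t) v, norm_indicator_eq_indicator_norm]
      rw [this, integral_indicator measurableSet_Ioi, setIntegral_const, hreal, smul_eq_mul,
        mul_comm]
      exact mul_le_mul_of_nonneg_right (norm_deriv_le_of_lipschitz hg) (Real.exp_pos _).le
  have hftc : ∀ v : ℝ, g (η * √(2 * v)) - g (-(η * √(2 * v))) =
      ∫ t, A.indicator (fun q => deriv g q.2) (v, t) := by
    intro v
    set a := η * √(2 * v) with ha
    have ha0 : 0 ≤ a := by positivity
    rw [← (hg.lipschitzOnWith (s := Set.uIcc (-a) a)).absolutelyContinuousOnInterval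
      |>.integral_deriv_eq_sub, intervalIntegral.integral_of_le (by linarith),
      integral_Ioc_eq_integral_Ioo, ← integral_indicator measurableSet_Ioo]
    congr 1
    ext t
    simp only [Set.indicator, hA, Set.mem_ofPred_eq, Set.mem_Ioo, abs_lt, ← ha]
  simp_rw [hftc]
  rw [integral_integral_swap hint]
  refine integral_congr_ae (Eventually.of_forall fun t => ?_)
  simp only
  rw [hsec, integral_indicator measurableSet_Ioi, setIntegral_const, hreal, smul_eq_mul, mul_comm]

/-- The variance `η²` as a nonnegative real, the form in which `gaussianReal` takes it. -/
def sqNN (η : ℝ) : NNReal := ⟨η ^ 2, sq_nonneg η⟩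

lemma sqNN_ne_zero {η : ℝ} (hη : 0 < η) : sqNN η ≠ 0 := fun h => by
  have : η ^ 2 = 0 := congrArg NNReal.toReal h
  exact (pow_pos hη 2).ne' this

lemma integral_exp_shift_eq_gaussian {g : ℝ → ℝ} {L : NNReal} (hg : LipschitzWith L g) {η : ℝ}
    (hη : 0 < η) :
    ∫ v, 1 / (η * √(2 * Real.pi)) * (g (η * √(2 * v)) - g (-(η * √(2 * v)))) ∂(expMeasure 1) =
      ∫ t, deriv g t ∂(gaussianReal 0 (sqNN η)) := by
  rw [integral_const_mul, integral_exp_shift hg hη,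
    integral_gaussianReal_eq_integral_smul (sqNN_ne_zero hη), ← integral_const_mul]
  refine integral_congr_ae (Eventually.of_forall fun t => ?_)
  have h1 : √(2 * Real.pi * η ^ 2) = η * √(2 * Real.pi) := by
    rw [Real.sqrt_mul (by positivity), Real.sqrt_sq hη.le, mul_comm]
  have h2 : ((sqNN η : NNReal) : ℝ) = η ^ 2 := rfl
  simp only [gaussianPDFReal, h2, h1, smul_eq_mul, sub_zero, one_div, neg_div]
  ring

/-! ### The law of the Gaussian perturbation -/

lemma multivariateGaussian_eq_map_pi {n : ℕ} (η : ℝ) :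
    multivariateGaussian (0 : EuclideanSpace ℝ (Fin n)) (η ^ 2 • 1) =
      (Measure.pi (fun _ : Fin n => gaussianReal 0 (sqNN η))).map (WithLp.toLp 2) := by
  apply Measure.ext_of_charFun
  ext t
  have hS : (η ^ 2 • (1 : Matrix (Fin n) (Fin n) ℝ)).PosSemidef :=
    Matrix.PosSemidef.one.smul (sq_nonneg η)
  rw [charFun_multivariateGaussian hS, charFun_pi]
  simp_rw [charFun_gaussianReal, ← Complex.exp_sum]
  congr 1
  have h2 : ((sqNN η : NNReal) : ℝ) = η ^ 2 := rfl
  simp only [inner_zero_right, Matrix.smul_mulVec, Matrix.one_mulVec, dotProduct, h2,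
    Complex.ofReal_zero, mul_zero, zero_mul, zero_sub, Finset.sum_neg_distrib, ← Finset.sum_div]
  push_cast
  congr 2
  refine Finset.sum_congr rfl fun i _ => ?_
  rw [Pi.smul_apply, smul_eq_mul]
  push_cast
  ring

lemma multivariateGaussian_eq_map_smul {n : ℕ} (η : ℝ) :
    multivariateGaussian (0 : EuclideanSpace ℝ (Fin n)) (η ^ 2 • 1) =
      (stdGaussian (EuclideanSpace ℝ (Fin n))).map (fun z => η • z) := by
  apply Measure.ext_of_charFun
  ext t
  have hS : (η ^ 2 • (1 : Matrix (Fin n) (Fin n) ℝ)).PosSemidef :=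
    Matrix.PosSemidef.one.smul (sq_nonneg η)
  rw [charFun_multivariateGaussian hS, charFun_map_smul, charFun_stdGaussian]
  congr 1
  have : (t.ofLp ⬝ᵥ t.ofLp : ℝ) = ‖t‖ ^ 2 := by
    rw [EuclideanSpace.real_norm_sq_eq]
    exact Finset.sum_congr rfl fun i _ => by ring
  simp only [inner_zero_right, Matrix.smul_mulVec, Matrix.one_mulVec, dotProduct_smul, this,
    smul_eq_mul, Complex.ofReal_zero, zero_mul, zero_sub, norm_smul]
  rw [← Complex.ofReal_pow, mul_pow, Real.norm_eq_abs, sq_abs, neg_div]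

lemma pi_absolutelyContinuous {n : ℕ} {μ ν : Measure ℝ} [SigmaFinite μ] [SigmaFinite ν]
    (h : μ ≪ ν) : Measure.pi (fun _ : Fin n => μ) ≪ Measure.pi (fun _ : Fin n => ν) := by
  induction n with
  | zero => rw [Measure.pi_of_empty, Measure.pi_of_empty]
  | succ n ih =>
    have h1 := (measurePreserving_piFinSuccAbove (fun _ : Fin (n + 1) => μ) 0).symm
    have h2 := (measurePreserving_piFinSuccAbove (fun _ : Fin (n + 1) => ν) 0).symm
    rw [← h1.map_eq, ← h2.map_eq]
    exact (h.prod ih).map (MeasurableEquiv.measurable _)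

lemma multivariateGaussian_absolutelyContinuous {n : ℕ} {η : ℝ} (hη : 0 < η) :
    multivariateGaussian (0 : EuclideanSpace ℝ (Fin n)) (η ^ 2 • 1) ≪ volume := by
  rw [multivariateGaussian_eq_map_pi, ← (PiLp.volume_preserving_toLp (Fin n)).map_eq]
  exact (pi_absolutelyContinuous (gaussianReal_absolutelyContinuous 0 (sqNN_ne_zero hη))).map
    (WithLp.measurable_toLp 2 _)

lemma shiftPoint_eq {n : ℕ} (x : EuclideanSpace ℝ (Fin n)) (i : Fin n) (t : ℝ)
    (z : EuclideanSpace ℝ (Fin n)) :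
    shiftPoint x i t z = shiftPoint x i 0 z + t • EuclideanSpace.single i 1 := by
  ext j
  by_cases h : j = i <;> simp [shiftPoint, h]

lemma measurable_shiftPoint {n : ℕ} (i : Fin n) :
    Measurable (fun q : EuclideanSpace ℝ (Fin n) × ℝ × EuclideanSpace ℝ (Fin n) =>
      shiftPoint q.1 i q.2.1 q.2.2) := by
  refine (WithLp.measurable_toLp 2 _).comp (measurable_pi_lambda _ fun j => ?_)
  by_cases h : j = i
  · simp only [h, if_true]
    fun_prop
  · simp only [h, if_false]
    fun_prop

lemma measurable_update_neg {n : ℕ} (i : Fin n) :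
    Measurable (fun q : ℝ × (Fin n → ℝ) => Function.update q.2 i (-q.1)) :=
  measurable_pi_lambda _ fun j => by
    by_cases h : j = i
    · subst h
      simp only [Function.update_self]
      fun_prop
    · simp only [Function.update_of_ne h]
      fun_prop

lemma pi_gaussian_update {n : ℕ} (i : Fin n) (s : NNReal) :
    ((gaussianReal 0 s).prod (Measure.pi (fun _ : Fin n => gaussianReal 0 s))).map
      (fun q => Function.update q.2 i (-q.1)) = Measure.pi (fun _ : Fin n => gaussianReal 0 s) := by
  have hm := measurable_update_neg (n := n) i
  refine (Measure.pi_eq fun B hB => ?_).symm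
  rw [Measure.map_apply hm (MeasurableSet.univ_pi hB)]
  have hpre : (fun q : ℝ × (Fin n → ℝ) => Function.update q.2 i (-q.1)) ⁻¹' (Set.univ.pi B) =
      ((fun t : ℝ => -t) ⁻¹' B i) ×ˢ (Set.univ.pi (Function.update B i Set.univ)) := by
    ext q
    simp only [Set.mem_preimage, Set.mem_pi, Set.mem_univ, true_imp_iff, Set.mem_prod]
    constructor
    · refine fun h => ⟨by simpa using h i, fun j => ?_⟩
      by_cases hj : j = i
      · subst hj
        simp
      · simpa [hj] using h j
    · rintro ⟨h1, h2⟩ j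
      by_cases hj : j = i
      · subst hj
        simpa using h1
      · simpa [hj] using h2 j
  have hneg : gaussianReal 0 s ((fun t : ℝ => -t) ⁻¹' B i) = gaussianReal 0 s (B i) := by
    rw [← Measure.map_apply measurable_neg (hB i), gaussianReal_map_neg, neg_zero]
  rw [hpre, Measure.prod_prod, Measure.pi_pi, hneg,
    ← Finset.mul_prod_erase Finset.univ _ (Finset.mem_univ i),
    ← Finset.mul_prod_erase Finset.univ (fun j => gaussianReal 0 s (B j)) (Finset.mem_univ i)]
  simp only [Function.update_self, measure_univ, one_mul]
  congr 1
  exact Finset.prod_congr rfl fun j hj => by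
    rw [Function.update_of_ne (Finset.ne_of_mem_erase hj)]

/-- Replacing the `i`-th coordinate of the Gaussian perturbation by an independent copy (of the
opposite sign) does not change its law. -/
lemma map_shiftPoint {n : ℕ} (x : EuclideanSpace ℝ (Fin n)) (i : Fin n) (η : ℝ) :
    ((gaussianReal 0 (sqNN η)).prod (multivariateGaussian 0 (η ^ 2 • 1))).map
      (fun q => shiftPoint x i q.1 q.2) =
      (multivariateGaussian 0 (η ^ 2 • 1)).map (fun z => x - z) := by
  have hu := measurable_update_neg (n := n) i
  have hs : Measurable (fun q : ℝ × EuclideanSpace ℝ (Fin n) => shiftPoint x i q.1 q.2) :=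
    (measurable_shiftPoint i).comp (measurable_const.prodMk measurable_id)
  have ht : Measurable (WithLp.toLp 2 : (Fin n → ℝ) → EuclideanSpace ℝ (Fin n)) :=
    WithLp.measurable_toLp 2 _
  rw [multivariateGaussian_eq_map_pi]
  have hprod := Measure.map_prod_map (gaussianReal 0 (sqNN η))
    (Measure.pi (fun _ : Fin n => gaussianReal 0 (sqNN η))) measurable_id ht
  rw [Measure.map_id] at hprod
  rw [hprod, Measure.map_map hs (by fun_prop)]
  conv_rhs => rw [← pi_gaussian_update i]
  rw [Measure.map_map ht hu, Measure.map_map (by fun_prop) (ht.comp hu)]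
  congr 1
  ext q j
  by_cases h : j = i
  · subst h
    simp [shiftPoint]
  · simp [shiftPoint, h]

/-! ### Gaussian smoothing of a convex Lipschitz function -/

lemma integrable_sqrt_exp : Integrable (fun v => √(2 * v)) (expMeasure 1) := by
  have h1 : Integrable (fun v : ℝ => v) (expMeasure 1) := by
    refine ⟨by fun_prop, ?_⟩
    rw [hasFiniteIntegral_iff_norm]
    refine lt_of_eq_of_lt ?_ ENNReal.one_lt_top
    rw [← lintegral_id_expMeasure]
    refine lintegral_congr_ae ?_
    filter_upwards [ae_exp_nonneg] with v hv
    rw [Real.norm_of_nonneg hv]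
  refine ((integrable_const (1 : ℝ)).add (h1.const_mul 2)).mono' (by fun_prop) ?_
  filter_upwards [ae_exp_nonneg] with v hv
  rw [Real.norm_of_nonneg (Real.sqrt_nonneg _), Pi.add_apply, Real.sqrt_le_left (by positivity)]
  nlinarith

lemma dist_shiftPoint {n : ℕ} (x : EuclideanSpace ℝ (Fin n)) (i : Fin n) (t : ℝ)
    (z : EuclideanSpace ℝ (Fin n)) :
    ‖shiftPoint x i t z - shiftPoint x i (-t) z‖ = 2 * |t| := by
  rw [shiftPoint_eq x i t, shiftPoint_eq x i (-t)]
  have : shiftPoint x i 0 z + t • EuclideanSpace.single i (1 : ℝ) -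
      (shiftPoint x i 0 z + (-t) • EuclideanSpace.single i (1 : ℝ)) =
      (2 * t) • EuclideanSpace.single i (1 : ℝ) := by
    module
  rw [this, norm_smul, PiLp.norm_single, norm_one, mul_one, Real.norm_eq_abs, abs_mul,
    abs_two]

/-- In expectation, the `i`-th component of the estimator for a deterministic integrand `f` is the
`i`-th partial derivative of `f` averaged over the Gaussian perturbation. The exponential variable
supplies the `i`-th coordinate of the perturbation, `z` the other ones. -/
lemma integral_symmetric_difference {n : ℕ} {f : EuclideanSpace ℝ (Fin n) → ℝ} {L : NNReal}
    (hf : LipschitzWith L f) {η : ℝ} (hη : 0 < η) (x : EuclideanSpace ℝ (Fin n)) (i : Fin n) :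
    ∫ q : ℝ × EuclideanSpace ℝ (Fin n), 1 / (η * √(2 * Real.pi)) *
      (f (shiftPoint x i (η * √(2 * q.1)) q.2) - f (shiftPoint x i (-(η * √(2 * q.1))) q.2))
      ∂((expMeasure 1).prod (multivariateGaussian 0 (η ^ 2 • 1))) =
    ∫ z, lineDeriv ℝ f (x - z) (EuclideanSpace.single i 1)
      ∂(multivariateGaussian 0 (η ^ 2 • 1)) := by
  set e : EuclideanSpace ℝ (Fin n) := EuclideanSpace.single i 1
  have hsm : Measurable (fun q : ℝ × EuclideanSpace ℝ (Fin n) => shiftPoint x i q.1 q.2) :=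
    (measurable_shiftPoint i).comp (measurable_const.prodMk measurable_id)
  have hdm : Measurable (fun y => lineDeriv ℝ f y e) := measurable_lineDeriv hf.continuous
  have hmeas : Measurable (fun q : ℝ × EuclideanSpace ℝ (Fin n) => 1 / (η * √(2 * Real.pi)) *
      (f (shiftPoint x i (η * √(2 * q.1)) q.2) - f (shiftPoint x i (-(η * √(2 * q.1))) q.2))) := by
    refine measurable_const.mul (Measurable.sub ?_ ?_)
    · exact hf.continuous.measurable.comp (hsm.comp (Measurable.prodMk (by fun_prop) (by fun_prop)))
    · exact hf.continuous.measurable.comp (hsm.comp (Measurable.prodMk (by fun_prop) (by fun_prop)))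
  rw [integral_prod_symm]
  · have h1 : ∀ z : EuclideanSpace ℝ (Fin n), ∫ v, 1 / (η * √(2 * Real.pi)) *
        (f (shiftPoint x i (η * √(2 * v)) z) - f (shiftPoint x i (-(η * √(2 * v))) z))
        ∂(expMeasure 1) = ∫ t, lineDeriv ℝ f (shiftPoint x i t z) e
          ∂(gaussianReal 0 (sqNN η)) := by
      intro z
      have hg : LipschitzWith L (fun t : ℝ => f (shiftPoint x i 0 z + t • e)) := by
        refine LipschitzWith.of_dist_le_mul fun s t => (hf.dist_le_mul _ _).trans_eq ?_
        rw [dist_add_left, dist_eq_norm, ← sub_smul, norm_smul, PiLp.norm_single,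
          norm_one, mul_one, dist_eq_norm]
      have h := integral_exp_shift_eq_gaussian hg hη
      simp only [e, ← shiftPoint_eq] at h
      rw [h]
      refine integral_congr_ae (Eventually.of_forall fun t => ?_)
      have : (fun s : ℝ => f (shiftPoint x i t z + s • e)) =
          fun s => (fun r : ℝ => f (shiftPoint x i r z)) (t + s) := by
        ext s
        simp only [e]
        rw [shiftPoint_eq x i t, shiftPoint_eq x i (t + s), add_smul, add_assoc]
      simp only [lineDeriv]
      have hd := deriv_comp_const_add (f := fun r : ℝ => f (shiftPoint x i r z)) t 0
      rw [add_zero] at hd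
      rw [this]
      exact hd.symm
    simp_rw [h1]
    have hint : Integrable (fun q : ℝ × EuclideanSpace ℝ (Fin n) =>
        lineDeriv ℝ f (shiftPoint x i q.1 q.2) e)
        ((gaussianReal 0 (sqNN η)).prod (multivariateGaussian 0 (η ^ 2 • 1))) :=
      Integrable.of_bound (hdm.comp hsm).aestronglyMeasurable (L * ‖e‖)
        (Eventually.of_forall fun q => norm_lineDeriv_le_of_lipschitz ℝ hf)
    rw [← integral_prod_symm _ hint]
    have h2 := integral_map (μ := (gaussianReal 0 (sqNN η)).prod
      (multivariateGaussian 0 (η ^ 2 • 1))) hsm.aemeasurable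
      (f := fun y => lineDeriv ℝ f y e) hdm.aestronglyMeasurable
    rw [← h2, map_shiftPoint, integral_map (by fun_prop) hdm.aestronglyMeasurable]
  · have hb : Integrable (fun q : ℝ × EuclideanSpace ℝ (Fin n) =>
        1 / (η * √(2 * Real.pi)) * (L * (2 * (η * √(2 * q.1)))))
        ((expMeasure 1).prod (multivariateGaussian 0 (η ^ 2 • 1))) :=
      ((((integrable_sqrt_exp.comp_fst _).const_mul η).const_mul 2).const_mul _).const_mul _
    refine hb.mono' hmeas.aestronglyMeasurable (Eventually.of_forall fun q => ?_)
    rw [norm_mul, Real.norm_of_nonneg (by positivity)]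
    refine mul_le_mul_of_nonneg_left ?_ (by positivity)
    refine (hf.norm_sub_le _ _).trans_eq ?_
    rw [dist_shiftPoint, abs_of_nonneg (by positivity)]

/-- The Gaussian smoothing `x ↦ 𝔼 f (x - z)`, `z ∼ N(0, η² I)`. -/
noncomputable def smoothing {n : ℕ} (f : EuclideanSpace ℝ (Fin n) → ℝ) (η : ℝ)
    (x : EuclideanSpace ℝ (Fin n)) : ℝ :=
  ∫ z, f (x - z) ∂(multivariateGaussian 0 (η ^ 2 • 1))

lemma integrable_comp_sub {n : ℕ} {f : EuclideanSpace ℝ (Fin n) → ℝ} {L : NNReal}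
    (hf : LipschitzWith L f) (η : ℝ) (x : EuclideanSpace ℝ (Fin n)) :
    Integrable (fun z => f (x - z)) (multivariateGaussian 0 (η ^ 2 • 1)) := by
  have h1 : Integrable (fun z : EuclideanSpace ℝ (Fin n) => ‖z‖)
      (multivariateGaussian 0 (η ^ 2 • 1)) := IsGaussian.integrable_id.norm
  refine ((integrable_const |f x|).add (h1.const_mul L)).mono'
    (hf.continuous.comp (by fun_prop)).aestronglyMeasurable (Eventually.of_forall fun z => ?_)
  have h := hf.norm_sub_le (x - z) x
  rw [sub_sub_cancel_left, norm_neg] at h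
  have h2 := norm_sub_norm_le (f (x - z)) (f x)
  simp only [Pi.add_apply, ← Real.norm_eq_abs]
  linarith

lemma integral_norm_gaussian {n : ℕ} {η : ℝ} (hη : 0 < η) :
    ∫ z : EuclideanSpace ℝ (Fin n), ‖z‖ ∂(multivariateGaussian 0 (η ^ 2 • 1)) =
      η * ∫ z : EuclideanSpace ℝ (Fin n), ‖z‖ ∂(stdGaussian (EuclideanSpace ℝ (Fin n))) := by
  rw [multivariateGaussian_eq_map_smul, integral_map (by fun_prop) (by fun_prop),
    ← integral_const_mul]
  simp_rw [norm_smul, Real.norm_of_nonneg hη.le]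

lemma abs_smoothing_sub_le {n : ℕ} {f : EuclideanSpace ℝ (Fin n) → ℝ} {L : NNReal}
    (hf : LipschitzWith L f) {η : ℝ} (hη : 0 < η) (x : EuclideanSpace ℝ (Fin n)) :
    |smoothing f η x - f x| ≤ L * (η * ∫ z : EuclideanSpace ℝ (Fin n), ‖z‖
      ∂(stdGaussian (EuclideanSpace ℝ (Fin n)))) := by
  have h1 : Integrable (fun z : EuclideanSpace ℝ (Fin n) => ‖z‖)
      (multivariateGaussian 0 (η ^ 2 • 1)) := IsGaussian.integrable_id.norm
  have h2 : smoothing f η x - f x =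
      ∫ z, (f (x - z) - f x) ∂(multivariateGaussian 0 (η ^ 2 • 1)) := by
    rw [integral_sub (integrable_comp_sub hf η x) (integrable_const _)]
    simp [smoothing]
  rw [h2, ← integral_norm_gaussian hη, ← integral_const_mul, ← Real.norm_eq_abs]
  refine norm_integral_le_of_norm_le (h1.const_mul _) (Eventually.of_forall fun z => ?_)
  have h := hf.norm_sub_le (x - z) x
  rwa [sub_sub_cancel_left, norm_neg] at h

lemma fderiv_le_sub_of_convexOn {E : Type*} [NormedAddCommGroup E] [NormedSpace ℝ E] {f : E → ℝ}
    (hf : ConvexOn ℝ Set.univ f) {y : E} (hd : DifferentiableAt ℝ f y) (h : E) :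
    fderiv ℝ f y h ≤ f (y + h) - f y := by
  have hl : HasDerivAt (fun t : ℝ => f (y + t • h)) (fderiv ℝ f y h) 0 :=
    hd.hasFDerivAt.hasLineDerivAt h
  have hc : ConvexOn ℝ Set.univ (fun t : ℝ => f (y + t • h)) := by
    have := hf.comp_affineMap (AffineMap.lineMap y (y + h) : ℝ →ᵃ[ℝ] E)
    rw [Set.preimage_univ] at this
    refine this.congr fun t _ => ?_
    simp [AffineMap.lineMap_apply, add_comm]
  have := hc.le_slope_of_hasDerivAt (Set.mem_univ 0) (Set.mem_univ 1) one_pos hl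
  simpa [slope_def_field] using this

/-- The vector of averaged partial derivatives is a subgradient of the smoothing. By
Rademacher's theorem a Lipschitz function is differentiable almost everywhere, and the
perturbation has a density, so the subgradient inequality of `f` can be averaged. -/
lemma smoothing_subgradient {n : ℕ} {f : EuclideanSpace ℝ (Fin n) → ℝ} {L : NNReal}
    (hf : LipschitzWith L f) (hc : ConvexOn ℝ Set.univ f) {η : ℝ} (hη : 0 < η)
    (x h : EuclideanSpace ℝ (Fin n)) :
    ∑ i, h i * ∫ z, lineDeriv ℝ f (x - z) (EuclideanSpace.single i 1)
      ∂(multivariateGaussian 0 (η ^ 2 • 1)) ≤ smoothing f η (x + h) - smoothing f η x := by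
  have hint : ∀ i : Fin n, Integrable (fun z => lineDeriv ℝ f (x - z) (EuclideanSpace.single i 1))
      (multivariateGaussian 0 (η ^ 2 • 1)) := fun i =>
    Integrable.of_bound ((measurable_lineDeriv hf.continuous).comp
      (by fun_prop : Measurable fun z => x - z)).aestronglyMeasurable
      (L * ‖(EuclideanSpace.single i 1 : EuclideanSpace ℝ (Fin n))‖)
      (Eventually.of_forall fun q => norm_lineDeriv_le_of_lipschitz ℝ hf)
  simp_rw [← integral_const_mul]
  rw [← integral_finsetSum _ fun i _ => (hint i).const_mul _, smoothing, smoothing,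
    ← integral_sub (integrable_comp_sub hf η _) (integrable_comp_sub hf η _)]
  refine integral_mono_ae (integrable_finsetSum _ fun i _ => (hint i).const_mul _)
    ((integrable_comp_sub hf η _).sub (integrable_comp_sub hf η _)) ?_
  have hae : ∀ᵐ z ∂(volume : Measure (EuclideanSpace ℝ (Fin n))), DifferentiableAt ℝ f (x - z) :=
    (Measure.measurePreserving_sub_left volume x).quasiMeasurePreserving.ae hf.ae_differentiableAt
  filter_upwards [(multivariateGaussian_absolutelyContinuous hη).ae_le hae] with z hz
  have h1 := fderiv_le_sub_of_convexOn hc hz h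
  have h2 : x - z + h = x + h - z := by abel
  rw [h2] at h1
  refine le_trans (le_of_eq ?_) h1
  have h3 : h = ∑ i, h i • (EuclideanSpace.single i 1 : EuclideanSpace ℝ (Fin n)) := by
    simpa using ((EuclideanSpace.basisFun (Fin n) ℝ).sum_repr h).symm
  conv_rhs => rw [h3]
  rw [map_sum]
  exact Finset.sum_congr rfl fun i _ => by
    rw [map_smul, smul_eq_mul, hz.lineDeriv_eq_fderiv]

/-! ### One step of the stochastic gradient scheme -/

/-- What the three settings have in common: a jointly measurable integrand `H`, Lipschitz in
`L²(P)`, whose expectation is the convex objective `f`. -/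
structure LipschitzIntegrand {n : ℕ} {S : Type*} [MeasurableSpace S] (P : Measure S)
    (H : EuclideanSpace ℝ (Fin n) → S → ℝ) (f : EuclideanSpace ℝ (Fin n) → ℝ) (L : NNReal) :
    Prop where
  measurable : Measurable (Function.uncurry H)
  integrable : ∀ x, Integrable (H x) P
  integral_eq : ∀ x, ∫ s, H x s ∂P = f x
  lipschitz : ∀ x y, eLpNorm (fun s => H x s - H y s) 2 P ≤ ENNReal.ofReal (L * ‖x - y‖)
  convex : ConvexOn ℝ Set.univ f

/-- The joint law of the samples `(V, Z, s)` drawn in one iteration. -/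
noncomputable def sampleLaw {S : Type*} [MeasurableSpace S] (n : ℕ) (P : Measure S) (η : ℝ) :
    Measure (ℝ × EuclideanSpace ℝ (Fin n) × S) :=
  (expMeasure 1).prod ((multivariateGaussian 0 (η ^ 2 • 1)).prod P)

instance {S : Type*} [MeasurableSpace S] (n : ℕ) (P : Measure S) [IsProbabilityMeasure P] (η : ℝ) :
    IsProbabilityMeasure (sampleLaw n P η) := by
  unfold sampleLaw
  infer_instance

lemma lintegral_enorm_sq_le {S : Type*} [MeasurableSpace S] {P : Measure S} {u : S → ℝ}
    {a : ENNReal} (h : eLpNorm u 2 P ≤ a) :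
    ∫⁻ s, ‖u s‖ₑ ^ 2 ∂P ≤ a ^ 2 := by
  have h1 := eLpNorm_nnreal_pow_eq_lintegral (f := u) (μ := P) (p := 2) two_ne_zero
  simp only [NNReal.coe_ofNat, ENNReal.rpow_ofNat, ENNReal.coe_ofNat] at h1
  rw [← h1]
  exact pow_le_pow_left' h 2

section

variable {n : ℕ} {S : Type*} [MeasurableSpace S] {P : Measure S} [IsProbabilityMeasure P]
  {H : EuclideanSpace ℝ (Fin n) → S → ℝ} {f : EuclideanSpace ℝ (Fin n) → ℝ} {L : NNReal}

lemma LipschitzIntegrand.lipschitzWith (h : LipschitzIntegrand P H f L) : LipschitzWith L f := by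
  refine LipschitzWith.of_dist_le_mul fun x y => ?_
  have hint : Integrable (fun s => H x s - H y s) P := (h.integrable x).sub (h.integrable y)
  rw [dist_eq_norm, dist_eq_norm, ← h.integral_eq x, ← h.integral_eq y,
    ← integral_sub (h.integrable x) (h.integrable y)]
  have h1 : eLpNorm (fun s => H x s - H y s) 1 P ≤ ENNReal.ofReal (L * ‖x - y‖) :=
    (eLpNorm_le_eLpNorm_of_exponent_le (by norm_num) hint.aestronglyMeasurable).trans
      (h.lipschitz x y)
  rw [eLpNorm_one_eq_lintegral_enorm] at h1
  have h2 := (enorm_integral_le_lintegral_enorm (μ := P) (fun s => H x s - H y s)).trans h1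
  rw [← ofReal_norm] at h2
  exact (ENNReal.ofReal_le_ofReal_iff (by positivity)).1 h2

lemma measurable_estimator {H : EuclideanSpace ℝ (Fin n) → S → ℝ}
    (hH : Measurable (Function.uncurry H)) (η : ℝ) :
    Measurable (fun q : EuclideanSpace ℝ (Fin n) × ℝ × EuclideanSpace ℝ (Fin n) × S =>
      estimator H η q.1 q.2.1 q.2.2.1 q.2.2.2) := by
  refine (WithLp.measurable_toLp 2 _).comp (measurable_pi_lambda _ fun i => ?_)
  refine measurable_const.mul (Measurable.sub ?_ ?_)
  · exact hH.comp (((measurable_shiftPoint i).comp (measurable_fst.prodMk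
      (Measurable.prodMk (by fun_prop) (by fun_prop)))).prodMk (by fun_prop))
  · exact hH.comp (((measurable_shiftPoint i).comp (measurable_fst.prodMk
      (Measurable.prodMk (by fun_prop) (by fun_prop)))).prodMk (by fun_prop))

lemma measurable_estimator_apply {H : EuclideanSpace ℝ (Fin n) → S → ℝ}
    (hH : Measurable (Function.uncurry H)) (η : ℝ) (x : EuclideanSpace ℝ (Fin n)) (i : Fin n) :
    Measurable (fun w : ℝ × EuclideanSpace ℝ (Fin n) × S =>
      estimator H η x w.1 w.2.1 w.2.2 i) := by
  have := (measurable_estimator hH η).comp (measurable_prodMk_left (x := x))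
  exact (measurable_pi_apply i).comp ((WithLp.measurable_ofLp 2 _).comp this)

/-- The two query points are at distance `2 η √(2v)`, so the factor `1 / η²` in the second moment
of the estimator cancels and the bound does not depend on `η`. -/
lemma LipschitzIntegrand.lintegral_estimator_sq_le (h : LipschitzIntegrand P H f L) {η : ℝ}
    (hη : 0 < η) (x : EuclideanSpace ℝ (Fin n)) (i : Fin n) :
    ∫⁻ w, ‖estimator H η x w.1 w.2.1 w.2.2 i‖ₑ ^ 2 ∂(sampleLaw n P η) ≤
      ENNReal.ofReal (4 / Real.pi * L ^ 2) := by
  have hm := measurable_estimator_apply h.measurable η x i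
  have hinner : ∀ (v : ℝ) (z : EuclideanSpace ℝ (Fin n)),
      ∫⁻ s, ‖estimator H η x v z s i‖ₑ ^ 2 ∂P ≤
        ENNReal.ofReal (4 / Real.pi * L ^ 2) * ENNReal.ofReal v := by
    intro v z
    have hL := h.lipschitz (shiftPoint x i (η * √(2 * v)) z) (shiftPoint x i (-(η * √(2 * v))) z)
    rw [dist_shiftPoint, abs_of_nonneg (by positivity)] at hL
    have hsq := lintegral_enorm_sq_le hL
    have hc : ∀ s, ‖estimator H η x v z s i‖ₑ ^ 2 = ‖1 / (η * √(2 * Real.pi))‖ₑ ^ 2 *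
        ‖H (shiftPoint x i (η * √(2 * v)) z) s - H (shiftPoint x i (-(η * √(2 * v))) z) s‖ₑ ^ 2 :=
      fun s => by rw [← mul_pow, ← enorm_mul]; rfl
    simp_rw [hc]
    rw [lintegral_const_mul' _ _ (by finiteness)]
    refine (mul_le_mul_right hsq _).trans (le_of_eq ?_)
    rw [← ofReal_norm, Real.norm_of_nonneg (by positivity),
      ← ENNReal.ofReal_pow (by positivity), ← ENNReal.ofReal_pow (by positivity),
      ← ENNReal.ofReal_mul (by positivity), ← ENNReal.ofReal_mul (by positivity)]
    -- For `v ≤ 0`, an event of probability zero, both sides vanish since `√(2 * v) = 0`.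
    rcases le_total v 0 with hv | hv
    · have h0 : √(2 * v) = 0 := Real.sqrt_eq_zero_of_nonpos (by linarith)
      rw [h0, ENNReal.ofReal_of_nonpos (p := 4 / Real.pi * (L : ℝ) ^ 2 * v)
        (mul_nonpos_of_nonneg_of_nonpos (by positivity) hv)]
      simp
    · congr 1
      have h1 : √(2 * v) ^ 2 = 2 * v := Real.sq_sqrt (by positivity)
      have h2 : √(2 * Real.pi) ^ 2 = 2 * Real.pi := Real.sq_sqrt (by positivity)
      rw [div_pow, mul_pow, h2]
      simp only [mul_pow, h1]
      field_simp
      ring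
  have hm2 : Measurable (fun w : ℝ × EuclideanSpace ℝ (Fin n) × S =>
      ‖estimator H η x w.1 w.2.1 w.2.2 i‖ₑ ^ 2) := hm.enorm.pow_const 2
  unfold sampleLaw
  rw [lintegral_prod _ hm2.aemeasurable]
  calc _ ≤ ∫⁻ v, ENNReal.ofReal (4 / Real.pi * L ^ 2) * ENNReal.ofReal v ∂(expMeasure 1) := by
        refine lintegral_mono fun v => ?_
        refine (lintegral_prod _ (hm2.comp measurable_prodMk_left).aemeasurable).trans_le ?_
        refine (lintegral_mono fun z => hinner v z).trans_eq ?_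
        simp
    _ = _ := by
        rw [lintegral_const_mul _ (by fun_prop), lintegral_id_expMeasure, mul_one]

lemma LipschitzIntegrand.memLp_estimator (h : LipschitzIntegrand P H f L) {η : ℝ}
    (hη : 0 < η) (x : EuclideanSpace ℝ (Fin n)) (i : Fin n) :
    MemLp (fun w => estimator H η x w.1 w.2.1 w.2.2 i) 2 (sampleLaw n P η) := by
  refine ⟨(measurable_estimator_apply h.measurable η x i).aestronglyMeasurable, ?_⟩
  refine (eLpNorm_lt_top_iff_lintegral_rpow_enorm_lt_top (by norm_num) (by norm_num)).2 ?_
  simp only [ENNReal.toReal_ofNat, ENNReal.rpow_ofNat]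
  exact (h.lintegral_estimator_sq_le hη x i).trans_lt ENNReal.ofReal_lt_top

lemma LipschitzIntegrand.integral_estimator_sq_le (h : LipschitzIntegrand P H f L) {η : ℝ}
    (hη : 0 < η) (x : EuclideanSpace ℝ (Fin n)) (i : Fin n) :
    ∫ w, estimator H η x w.1 w.2.1 w.2.2 i ^ 2 ∂(sampleLaw n P η) ≤ 4 / Real.pi * L ^ 2 := by
  rw [integral_eq_lintegral_of_nonneg_ae (Eventually.of_forall fun _ => sq_nonneg _)
    ((measurable_estimator_apply h.measurable η x i).pow_const 2).aestronglyMeasurable]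
  refine ENNReal.toReal_le_of_le_ofReal (by positivity)
    (le_of_eq_of_le ?_ (h.lintegral_estimator_sq_le hη x i))
  refine lintegral_congr fun w => ?_
  rw [← ofReal_norm, ← ENNReal.ofReal_pow (norm_nonneg _), Real.norm_eq_abs, sq_abs]

/-- The mean of the estimator does not see the sample `s`: integrating it out first replaces `H` by
the objective `f`. -/
lemma LipschitzIntegrand.integral_estimator (h : LipschitzIntegrand P H f L) {η : ℝ}
    (hη : 0 < η) (x : EuclideanSpace ℝ (Fin n)) (i : Fin n) :
    ∫ w, estimator H η x w.1 w.2.1 w.2.2 i ∂(sampleLaw n P η) =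
      ∫ z, lineDeriv ℝ f (x - z) (EuclideanSpace.single i 1)
        ∂(multivariateGaussian 0 (η ^ 2 • 1)) := by
  have hint := (h.memLp_estimator hη x i).integrable (by norm_num)
  rw [← integral_symmetric_difference h.lipschitzWith hη]
  unfold sampleLaw at hint ⊢
  rw [← Measure.prodAssoc_prod] at hint ⊢
  rw [integral_map_equiv]
  rw [integrable_map_equiv] at hint
  refine (integral_prod _ hint).trans ?_
  refine integral_congr_ae (Eventually.of_forall fun q => ?_)
  change ∫ s, 1 / (η * √(2 * Real.pi)) * (H (shiftPoint x i (η * √(2 * q.1)) q.2) s -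
    H (shiftPoint x i (-(η * √(2 * q.1))) q.2) s) ∂P = _
  rw [integral_const_mul, integral_sub (h.integrable _) (h.integrable _), h.integral_eq,
    h.integral_eq]

/-- The expected decrease of the squared distance to a point `y` that is at least as good as `x`,
before the projection. -/
lemma LipschitzIntegrand.descent (h : LipschitzIntegrand P H f L) {η γ : ℝ} (hη : 0 < η)
    (hγ : 0 < γ) {x y : EuclideanSpace ℝ (Fin n)} (hxy : f y ≤ f x) :
    ∫⁻ w, ENNReal.ofReal (‖x - γ • estimator H η x w.1 w.2.1 w.2.2 - y‖ ^ 2) ∂(sampleLaw n P η) +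
        ENNReal.ofReal (2 * γ * (f x - f y)) ≤
      ENNReal.ofReal (‖x - y‖ ^ 2) + ENNReal.ofReal
        (γ * η * (4 * L * ∫ z, ‖z‖ ∂(stdGaussian (EuclideanSpace ℝ (Fin n)))) +
          γ ^ 2 * (n * (4 / Real.pi * L ^ 2))) := by
  set C := ∫ z, ‖z‖ ∂(stdGaussian (EuclideanSpace ℝ (Fin n))) with hC
  have hC0 : 0 ≤ C := integral_nonneg fun _ => norm_nonneg _
  set g : (ℝ × EuclideanSpace ℝ (Fin n) × S) → EuclideanSpace ℝ (Fin n) :=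
    fun w => estimator H η x w.1 w.2.1 w.2.2 with hg
  have hi : ∀ i, Integrable (fun w => g w i) (sampleLaw n P η) := fun i =>
    (h.memLp_estimator hη x i).integrable (by norm_num)
  have hi2 : ∀ i, Integrable (fun w => g w i ^ 2) (sampleLaw n P η) := fun i =>
    (h.memLp_estimator hη x i).integrable_sq
  have hexpand : ∀ w, ‖x - γ • g w - y‖ ^ 2 =
      ‖x - y‖ ^ 2 + (2 * γ * ∑ i, (y - x) i * g w i + γ ^ 2 * ∑ i, g w i ^ 2) := by
    intro w
    simp only [EuclideanSpace.real_norm_sq_eq, Finset.mul_sum, ← Finset.sum_add_distrib]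
    refine Finset.sum_congr rfl fun i _ => ?_
    simp only [PiLp.sub_apply, PiLp.smul_apply, smul_eq_mul]
    ring
  have hI1 : Integrable (fun w => 2 * γ * ∑ i, (y - x) i * g w i) (sampleLaw n P η) :=
    (integrable_finsetSum _ fun i _ => (hi i).const_mul _).const_mul _
  have hI2 : Integrable (fun w => γ ^ 2 * ∑ i, g w i ^ 2) (sampleLaw n P η) :=
    (integrable_finsetSum _ fun i _ => hi2 i).const_mul _
  have hI : Integrable (fun w => ‖x - γ • g w - y‖ ^ 2) (sampleLaw n P η) := by
    simp_rw [hexpand]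
    exact (integrable_const _).add (hI1.add hI2)
  have hval : ∫ w, ‖x - γ • g w - y‖ ^ 2 ∂(sampleLaw n P η) ≤
      ‖x - y‖ ^ 2 + 2 * γ * (f y - f x + 2 * (L * (η * C))) +
        γ ^ 2 * (n * (4 / Real.pi * L ^ 2)) := by
    simp_rw [hexpand]
    rw [integral_add (integrable_const (‖x - y‖ ^ 2)) (by exact hI1.add hI2),
      integral_add hI1 hI2, integral_const_mul, integral_const_mul, integral_finsetSum _ fun i _ => (hi i).const_mul _,
      integral_finsetSum _ fun i _ => hi2 i]
    simp_rw [integral_const_mul]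
    have hmean : ∑ i, (y - x) i * ∫ w, g w i ∂(sampleLaw n P η) ≤
        f y - f x + 2 * (L * (η * C)) := by
      simp only [hg, h.integral_estimator hη x]
      have h1 := smoothing_subgradient h.lipschitzWith h.convex hη x (y - x)
      rw [add_sub_cancel] at h1
      have h2 := abs_le.1 (abs_smoothing_sub_le h.lipschitzWith hη x)
      have h3 := abs_le.1 (abs_smoothing_sub_le h.lipschitzWith hη y)
      linarith [h2.1, h3.2]
    have hsq : ∑ i, ∫ w, g w i ^ 2 ∂(sampleLaw n P η) ≤ n * (4 / Real.pi * L ^ 2) := by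
      refine (Finset.sum_le_card_nsmul _ _ _ fun i _ =>
        h.integral_estimator_sq_le hη x i).trans_eq ?_
      simp
    have e1 := mul_le_mul_of_nonneg_left hmean (by positivity : 0 ≤ 2 * γ)
    have e2 := mul_le_mul_of_nonneg_left hsq (by positivity : 0 ≤ γ ^ 2)
    simp only [integral_const, probReal_univ, one_smul]
    linarith
  rw [← ofReal_integral_eq_lintegral_ofReal hI (Eventually.of_forall fun _ => sq_nonneg _),
    ← ENNReal.ofReal_add (integral_nonneg fun _ => sq_nonneg _)
      (mul_nonneg (by positivity) (sub_nonneg.2 hxy)),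
    ← ENNReal.ofReal_add (sq_nonneg _) (by positivity)]
  refine ENNReal.ofReal_le_ofReal ?_
  linarith

end

/-! ### Almost supermartingales -/

lemma summable_and_tendsto_of_add {Y T : ℕ → ℝ} (hY : ∀ k, 0 ≤ Y k) (hT : ∀ k, 0 ≤ T k) {c : ℝ}
    (h : Tendsto (fun k => Y k + ∑ j ∈ Finset.range k, T j) atTop (𝓝 c)) :
    (∃ a, Tendsto Y atTop (𝓝 a)) ∧ Summable T := by
  obtain ⟨B, hB⟩ := h.bddAbove_range
  have hs : Summable T := summable_of_sum_range_le hT fun k =>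
    (le_add_of_nonneg_left (hY k)).trans (hB ⟨k, rfl⟩)
  refine ⟨⟨c - ∑' j, T j, ?_⟩, hs⟩
  refine (h.sub hs.hasSum.tendsto_sum_nat).congr fun k => ?_
  ring

section

variable {Ω : Type*} {m : MeasurableSpace Ω} {μ : Measure Ω} [IsProbabilityMeasure μ]
  {ℱ : Filtration ℕ m} {Y T : ℕ → Ω → ℝ} {b : ℕ → ℝ}

lemma almost_supermartingale_of_integrable (hY : ∀ k ω, 0 ≤ Y k ω) (hT : ∀ k ω, 0 ≤ T k ω)
    (hb : ∀ k, 0 ≤ b k) (hbs : Summable b) (hYm : ∀ k, Measurable[ℱ k] (Y k))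
    (hTm : ∀ k, Measurable[ℱ k] (T k)) (hint : Integrable (Y 0) μ)
    (hstep : ∀ k A, MeasurableSet[ℱ k] A →
      ∫⁻ ω in A, ENNReal.ofReal (Y (k + 1) ω) ∂μ + ∫⁻ ω in A, ENNReal.ofReal (T k ω) ∂μ ≤
        ∫⁻ ω in A, ENNReal.ofReal (Y k ω) ∂μ + ENNReal.ofReal (b k) * μ A) :
    ∀ᵐ ω ∂μ, (∃ a, Tendsto (fun k => Y k ω) atTop (𝓝 a)) ∧ Summable (fun k => T k ω) := by
  have hYm' : ∀ k, Measurable (Y k) := fun k => (hYm k).mono (ℱ.le k) le_rfl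
  have hTm' : ∀ k, Measurable (T k) := fun k => (hTm k).mono (ℱ.le k) le_rfl
  have hintY : ∀ k, Integrable (Y k) μ ∧ Integrable (T k) μ := by
    have key : ∀ k, Integrable (Y k) μ → Integrable (Y (k + 1)) μ ∧ Integrable (T k) μ := by
      intro k hk
      have h := hstep k Set.univ MeasurableSet.univ
      simp only [Measure.restrict_univ, measure_univ, mul_one] at h
      have hfin := h.trans_lt (ENNReal.add_lt_top.2 ⟨(lintegral_ofReal_ne_top_iff_integrable
        (hYm' k).aestronglyMeasurable (Eventually.of_forall (hY k))).2 hk |>.lt_top,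
        ENNReal.ofReal_lt_top⟩)
      rw [ENNReal.add_lt_top] at hfin
      exact ⟨(lintegral_ofReal_ne_top_iff_integrable
        (hYm' (k + 1)).aestronglyMeasurable (Eventually.of_forall (hY (k + 1)))).1 hfin.1.ne,
        (lintegral_ofReal_ne_top_iff_integrable
        (hTm' k).aestronglyMeasurable (Eventually.of_forall (hT k))).1 hfin.2.ne⟩
    have hY' : ∀ k, Integrable (Y k) μ := fun k => by
      induction k with
      | zero => exact hint
      | succ k ih => exact (key k ih).1
    exact fun k => ⟨hY' k, (key k (hY' k)).2⟩
  have hreal : ∀ k A, MeasurableSet[ℱ k] A →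
      ∫ ω in A, Y (k + 1) ω ∂μ + ∫ ω in A, T k ω ∂μ ≤ ∫ ω in A, Y k ω ∂μ + b k * μ.real A := by
    intro k A hA
    have h := hstep k A hA
    rw [← ofReal_integral_eq_lintegral_ofReal (hintY _).1.integrableOn
        (Eventually.of_forall (hY (k + 1))),
      ← ofReal_integral_eq_lintegral_ofReal (hintY _).1.integrableOn (Eventually.of_forall (hY k)),
      ← ofReal_integral_eq_lintegral_ofReal (hintY _).2.integrableOn (Eventually.of_forall (hT k)),
      ← ofReal_measureReal, ← ENNReal.ofReal_mul (hb k),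
      ← ENNReal.ofReal_add (integral_nonneg (hY _)) (integral_nonneg (hT _)),
      ← ENNReal.ofReal_add (integral_nonneg (hY _)) (mul_nonneg (hb k) measureReal_nonneg)] at h
    exact (ENNReal.ofReal_le_ofReal_iff (add_nonneg (integral_nonneg (hY _))
      (mul_nonneg (hb k) measureReal_nonneg))).1 h
  set W : ℕ → Ω → ℝ := fun k ω => Y k ω + ∑ j ∈ Finset.range k, T j ω with hW
  have hWint : ∀ k, Integrable (W k) μ := fun k =>
    (hintY k).1.add (integrable_finsetSum _ fun j _ => (hintY j).2)
  have hWstep : ∀ k A, MeasurableSet[ℱ k] A →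
      ∫ ω in A, W (k + 1) ω ∂μ ≤ ∫ ω in A, W k ω ∂μ + b k * μ.real A := by
    intro k A hA
    have hs : ∀ k, IntegrableOn (fun ω => ∑ j ∈ Finset.range k, T j ω) A μ := fun k =>
      (integrable_finsetSum _ fun j _ => (hintY j).2).integrableOn
    simp only [hW]
    rw [integral_add (hintY _).1.integrableOn (hs _), integral_add (hintY _).1.integrableOn (hs _)]
    simp only [Finset.sum_range_succ]
    rw [integral_add (hs _) (hintY _).2.integrableOn]
    linarith [hreal k A hA]
  have hWbound : ∀ k, ∫ ω, W k ω ∂μ ≤ ∫ ω, Y 0 ω ∂μ + ∑' j, b j := by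
    intro k
    have : ∫ ω, W k ω ∂μ ≤ ∫ ω, Y 0 ω ∂μ + ∑ j ∈ Finset.range k, b j := by
      induction k with
      | zero => simp [hW]
      | succ k ih =>
        have h := hWstep k Set.univ MeasurableSet.univ
        simp only [Measure.restrict_univ, probReal_univ, mul_one] at h
        rw [Finset.sum_range_succ]
        linarith
    linarith [hbs.sum_le_tsum (Finset.range k) fun j _ => hb j]
  set U : ℕ → Ω → ℝ := fun k ω => ∑ j ∈ Finset.range k, b j - W k ω with hU
  have hsub : Submartingale U ℱ μ := by
    refine submartingale_of_setIntegral_le_succ (fun k => ?_)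
      (fun k => (integrable_const _).sub (hWint k)) fun k A hA => ?_
    · refine Measurable.stronglyMeasurable (measurable_const.sub ((hYm k).add ?_))
      exact Finset.measurable_fun_sum _ fun j hj =>
        (hTm j).mono (ℱ.mono (Finset.mem_range.1 hj).le) le_rfl
    · simp only [hU]
      rw [integral_sub (integrable_const _) (hWint _).integrableOn,
        integral_sub (integrable_const _) (hWint _).integrableOn, Finset.sum_range_succ,
        setIntegral_const, setIntegral_const, smul_eq_mul, smul_eq_mul]
      linarith [hWstep k A hA]
  have hW0 : ∀ k ω, 0 ≤ W k ω := fun k ω =>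
    add_nonneg (hY k ω) (Finset.sum_nonneg fun j _ => hT j ω)
  have hbd : ∀ k, eLpNorm (U k) 1 μ ≤
      (∑' j, b j + (∫ ω, Y 0 ω ∂μ + ∑' j, b j)).toNNReal := by
    intro k
    have hUint : Integrable (U k) μ := (integrable_const _).sub (hWint k)
    rw [eLpNorm_one_eq_lintegral_enorm, ← ofReal_integral_norm_eq_lintegral_enorm hUint]
    refine ENNReal.ofReal_le_ofReal ?_
    calc ∫ ω, ‖U k ω‖ ∂μ ≤ ∫ ω, (∑' j, b j + W k ω) ∂μ := by
          refine integral_mono hUint.norm ((integrable_const _).add (hWint k)) fun ω => ?_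
          refine (norm_sub_le _ _).trans (add_le_add ?_ ?_)
          · rw [Real.norm_of_nonneg (Finset.sum_nonneg fun j _ => hb j)]
            exact hbs.sum_le_tsum _ fun j _ => hb j
          · rw [Real.norm_of_nonneg (hW0 k ω)]
      _ ≤ _ := by
          rw [integral_add (integrable_const _) (hWint k)]
          simpa using hWbound k
  filter_upwards [hsub.exists_ae_tendsto_of_bdd hbd] with ω ⟨c, hc⟩
  refine summable_and_tendsto_of_add (fun k => hY k ω) (fun k => hT k ω)
    (c := ∑' j, b j - c) ?_
  refine (hbs.hasSum.tendsto_sum_nat.sub hc).congr fun k => ?_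
  simp only [hU, hW]
  ring

/-- The Robbins-Siegmund theorem. The conditional inequality
`𝔼[Y (k+1) | ℱ k] + T k ≤ Y k + b k` is stated through integrals over the sets of `ℱ k`, in
extended nonnegative reals, so that `Y 0` need not be integrable. -/
lemma almost_supermartingale (hY : ∀ k ω, 0 ≤ Y k ω) (hT : ∀ k ω, 0 ≤ T k ω)
    (hb : ∀ k, 0 ≤ b k) (hbs : Summable b) (hYm : ∀ k, Measurable[ℱ k] (Y k))
    (hTm : ∀ k, Measurable[ℱ k] (T k))
    (hstep : ∀ k A, MeasurableSet[ℱ k] A →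
      ∫⁻ ω in A, ENNReal.ofReal (Y (k + 1) ω) ∂μ + ∫⁻ ω in A, ENNReal.ofReal (T k ω) ∂μ ≤
        ∫⁻ ω in A, ENNReal.ofReal (Y k ω) ∂μ + ENNReal.ofReal (b k) * μ A) :
    ∀ᵐ ω ∂μ, (∃ a, Tendsto (fun k => Y k ω) atTop (𝓝 a)) ∧ Summable (fun k => T k ω) := by
  -- Localize: on the `ℱ 0`-measurable event `Y 0 ≤ R` the process starts from a bounded value.
  set B : ℕ → Set Ω := fun R => {ω | Y 0 ω ≤ R} with hB
  have hBm : ∀ R k, MeasurableSet[ℱ k] (B R) := fun R k =>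
    ℱ.mono (Nat.zero_le k) _ (measurableSet_le (hYm 0) measurable_const)
  have hres : ∀ R : ℕ, ∀ᵐ ω ∂μ, (∃ a, Tendsto (fun k => (B R).indicator (Y k) ω) atTop (𝓝 a)) ∧
      Summable (fun k => (B R).indicator (T k) ω) := by
    intro R
    have hind : ∀ (g : Ω → ℝ) (A : Set Ω), ∫⁻ ω in A, ENNReal.ofReal ((B R).indicator g ω) ∂μ =
        ∫⁻ ω in A ∩ B R, ENNReal.ofReal (g ω) ∂μ := by
      intro g A
      have : (fun ω => ENNReal.ofReal ((B R).indicator g ω)) =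
          (B R).indicator (fun ω => ENNReal.ofReal (g ω)) := by
        ext ω
        by_cases h : ω ∈ B R <;> simp [h]
      rw [this, lintegral_indicator (ℱ.le 0 _ (hBm R 0)), Measure.restrict_restrict
        (ℱ.le 0 _ (hBm R 0)), Set.inter_comm]
    refine almost_supermartingale_of_integrable (ℱ := ℱ)
      (fun k => Set.indicator_nonneg fun ω _ => hY k ω)
      (fun k => Set.indicator_nonneg fun ω _ => hT k ω) hb hbs
      (fun k => (hYm k).indicator (hBm R k)) (fun k => (hTm k).indicator (hBm R k)) ?_ ?_
    · refine Integrable.of_bound (((hYm 0).mono (ℱ.le 0) le_rfl).indicator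
        (ℱ.le 0 _ (hBm R 0))).aestronglyMeasurable R (Eventually.of_forall fun ω => ?_)
      by_cases h : ω ∈ B R
      · rw [Set.indicator_of_mem h, Real.norm_of_nonneg (hY 0 ω)]
        exact h
      · rw [Set.indicator_of_notMem h, norm_zero]
        exact Nat.cast_nonneg R
    · intro k A hA
      rw [hind, hind, hind]
      refine (hstep k _ (hA.inter (hBm R k))).trans ?_
      gcongr
      exact Set.inter_subset_left
  filter_upwards [ae_all_iff.2 hres] with ω hω
  obtain ⟨R, hR⟩ := exists_nat_ge (Y 0 ω)
  have hmem : ω ∈ B R := hR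
  simpa only [Set.indicator_of_mem hmem] using hω R

end

/-! ### Convergence of a sequence of Fejér type -/

/-- If the distances of `x` to the points of a dense subset of `A` converge and `x` has a cluster
point in `A`, then `x` converges to it. -/
lemma tendsto_of_dense {E : Type*} [NormedAddCommGroup E] {A D : Set E} (hDA : A ⊆ closure D)
    {x : ℕ → E} (hD : ∀ d ∈ D, ∃ a, Tendsto (fun k => ‖x k - d‖ ^ 2) atTop (𝓝 a)) {p : E}
    (hp : p ∈ A) {φ : ℕ → ℕ} (hφ : StrictMono φ) (hx : Tendsto (x ∘ φ) atTop (𝓝 p)) :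
    Tendsto x atTop (𝓝 p) := by
  rw [Metric.tendsto_atTop]
  intro ε hε
  obtain ⟨d, hd, hpd⟩ := Metric.mem_closure_iff.1 (hDA hp) (ε / 2) (half_pos hε)
  obtain ⟨a, ha⟩ := hD d hd
  have h1 : Tendsto (fun k => ‖x k - d‖) atTop (𝓝 √a) := by
    simpa using ha.sqrt
  have h2 : Tendsto (fun k => ‖x (φ k) - d‖) atTop (𝓝 ‖p - d‖) :=
    (hx.sub tendsto_const_nhds).norm
  have h3 : √a = ‖p - d‖ := tendsto_nhds_unique (h1.comp hφ.tendsto_atTop) h2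
  rw [h3, ← dist_eq_norm] at h1
  obtain ⟨N, hN⟩ := eventually_atTop.1 (h1.eventually (gt_mem_nhds hpd))
  refine ⟨N, fun k hk => ?_⟩
  have h4 := hN k hk
  rw [← dist_eq_norm] at h4
  have h5 := dist_triangle_right (x k) p d
  linarith

/-- Summability of `γ k * u k` forces `u` to be small infinitely often, since `∑ γ k = ∞`. -/
lemma exists_subseq_tendsto_zero {γ u : ℕ → ℝ} (hγ : ∀ k, 0 < γ k) (hu : ∀ k, 0 ≤ u k)
    (hsum : Tendsto (fun N => ∑ k ∈ Finset.range N, γ k) atTop atTop)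
    (hs : Summable (fun k => γ k * u k)) :
    ∃ φ : ℕ → ℕ, StrictMono φ ∧ Tendsto (u ∘ φ) atTop (𝓝 0) := by
  have hfreq : ∀ ε > 0, ∃ᶠ k in atTop, u k < ε := by
    intro ε hε hcon
    have hev : ∀ᶠ k in atTop, ε ≤ u k := hcon.mono fun k hk => not_lt.1 hk
    have hγs : Summable γ := by
      refine summable_of_isBigO_nat hs (Asymptotics.IsBigO.of_bound ε⁻¹ ?_)
      filter_upwards [hev] with k hk
      rw [Real.norm_of_nonneg (hγ k).le, Real.norm_of_nonneg (mul_nonneg (hγ k).le (hu k)),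
        inv_mul_eq_div, le_div_iff₀ hε]
      exact mul_le_mul_of_nonneg_left hk (hγ k).le
    exact not_tendsto_nhds_of_tendsto_atTop hsum _ hγs.hasSum.tendsto_sum_nat
  obtain ⟨φ, hφ, h⟩ := extraction_forall_of_frequently (P := fun n k => u k < 1 / ((n : ℝ) + 1))
    fun n => hfreq _ Nat.one_div_pos_of_nat
  exact ⟨φ, hφ, squeeze_zero (fun k => hu _) (fun k => (h k).le)
    tendsto_one_div_add_atTop_nhds_zero_nat⟩

lemma exists_tendsto_optimalSet {n : ℕ} {X : Set (EuclideanSpace ℝ (Fin n))} (hX : IsClosed X)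
    {f : EuclideanSpace ℝ (Fin n) → ℝ} (hf : Continuous f) {D : Set (EuclideanSpace ℝ (Fin n))}
    (hDs : D ⊆ optimalSet X f) (hDc : optimalSet X f ⊆ closure D)
    {x : ℕ → EuclideanSpace ℝ (Fin n)} (hx : ∀ k, x k ∈ X)
    {d : EuclideanSpace ℝ (Fin n)} (hd : d ∈ D)
    {γ : ℕ → ℝ} (hγ : ∀ k, 0 < γ k)
    (hsum : Tendsto (fun N => ∑ k ∈ Finset.range N, γ k) atTop atTop)
    (hD : ∀ d ∈ D, ∃ a, Tendsto (fun k => ‖x k - d‖ ^ 2) atTop (𝓝 a))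
    (hs : Summable (fun k => γ k * (f (x k) - f d))) :
    ∃ p ∈ optimalSet X f, Tendsto x atTop (𝓝 p) := by
  obtain ⟨φ, hφ, h⟩ := exists_subseq_tendsto_zero hγ
    (fun k => sub_nonneg.2 ((hDs hd).2 _ (hx k))) hsum hs
  obtain ⟨a, ha⟩ := hD d hd
  obtain ⟨R, hR⟩ := ha.bddAbove_range
  have hball : ∀ k, x k ∈ Metric.closedBall d √R := fun k => by
    rw [mem_closedBall_iff_norm]
    exact Real.le_sqrt_of_sq_le (hR ⟨k, rfl⟩)
  obtain ⟨p, -, ψ, hψ, hp⟩ := (isCompact_closedBall d √R).tendsto_subseq fun k => hball (φ k)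
  have hpX : p ∈ X := hX.mem_of_tendsto hp (Eventually.of_forall fun k => hx _)
  have h1 : Tendsto (fun k => f (x (φ (ψ k))) - f d) atTop (𝓝 (f p - f d)) :=
    ((hf.tendsto p).comp hp).sub_const _
  have h2 := tendsto_nhds_unique h1 (h.comp hψ.tendsto_atTop)
  have hpo : p ∈ optimalSet X f := ⟨hpX, fun y hy => by linarith [(hDs hd).2 y hy]⟩
  exact ⟨p, hpo, tendsto_of_dense hDc hD hpo (hφ.comp hψ) hp⟩

/-! ### Euclidean projections -/

section

variable {n : ℕ} {X : Set (EuclideanSpace ℝ (Fin n))}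

lemma IsProjection.inner_le_zero (hX : Convex ℝ X) {u p : EuclideanSpace ℝ (Fin n)}
    (h : IsProjection X u p) {y : EuclideanSpace ℝ (Fin n)} (hy : y ∈ X) :
    inner ℝ (u - p) (y - p) ≤ 0 := by
  have : Nonempty X := ⟨⟨p, h.1⟩⟩
  refine (norm_eq_iInf_iff_real_inner_le_zero hX h.1).1 (le_antisymm ?_ ?_) y hy
  · exact le_ciInf fun w => h.2 w w.2
  · exact ciInf_le ⟨0, by rintro _ ⟨w, rfl⟩; exact norm_nonneg _⟩ (⟨p, h.1⟩ : X)

/-- The projection onto a convex set is nonexpansive. For `u = v` this is its uniqueness, and for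
`v ∈ X` it says that projecting does not increase the distance to points of `X`. -/
lemma IsProjection.norm_sub_le (hX : Convex ℝ X) {u p v q : EuclideanSpace ℝ (Fin n)}
    (hp : IsProjection X u p) (hq : IsProjection X v q) : ‖p - q‖ ≤ ‖u - v‖ := by
  have h1 := hp.inner_le_zero hX hq.1
  have h2 := hq.inner_le_zero hX hp.1
  have h3 : inner ℝ (u - p) (q - p) + inner ℝ (v - q) (p - q) =
      ‖p - q‖ ^ 2 - inner ℝ (u - v) (p - q) := by
    rw [← real_inner_self_eq_norm_sq, ← neg_sub p q, inner_neg_right, ← inner_neg_left,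
      ← inner_add_left, ← inner_sub_left]
    congr 1
    abel
  have h4 := real_inner_le_norm (u - v) (p - q)
  by_contra! hlt
  nlinarith [norm_nonneg (u - v)]

lemma isProjection_self {y : EuclideanSpace ℝ (Fin n)} (hy : y ∈ X) : IsProjection X y y :=
  ⟨hy, fun z _ => by simp⟩

lemma exists_measurable_projection (hX : Convex ℝ X) (hXc : IsClosed X) (hne : X.Nonempty) :
    ∃ π : EuclideanSpace ℝ (Fin n) → EuclideanSpace ℝ (Fin n), Measurable π ∧
      ∀ u p, IsProjection X u p → p = π u := by
  have hex : ∀ u, ∃ p, IsProjection X u p := by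
    intro u
    obtain ⟨p, hp, h⟩ := exists_norm_eq_iInf_of_complete_convex hne hXc.isComplete hX u
    refine ⟨p, hp, fun y hy => h.trans_le ?_⟩
    exact ciInf_le ⟨0, by rintro _ ⟨w, rfl⟩; exact norm_nonneg _⟩ (⟨y, hy⟩ : X)
  choose π hπ using hex
  refine ⟨π, ?_, fun u p h => ?_⟩
  · have : LipschitzWith 1 π := LipschitzWith.of_dist_le_mul fun u v => by
      rw [dist_eq_norm, dist_eq_norm, NNReal.coe_one, one_mul]
      exact (hπ u).norm_sub_le hX (hπ v)
    exact this.continuous.measurable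
  · have := h.norm_sub_le hX (hπ u)
    rwa [sub_self, norm_zero, norm_le_zero_iff, sub_eq_zero] at this

end

/-! ### Independence of the samples from the past -/

lemma indepFun_prodMk_of_indepFun {Ω α β δ : Type*} {mΩ : MeasurableSpace Ω} {μ : Measure Ω}
    [IsProbabilityMeasure μ] [MeasurableSpace α] [MeasurableSpace β] [MeasurableSpace δ]
    {A : Ω → α} {B : Ω → β} {C : Ω → δ} (hA : Measurable A) (hB : Measurable B)
    (hC : Measurable C) (h : IndepFun A (fun ω => (B ω, C ω)) μ) (hBC : IndepFun B C μ) :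
    IndepFun (fun ω => (A ω, B ω)) C μ := by
  have hAB : IndepFun A B μ := h.comp measurable_id measurable_fst
  rw [indepFun_iff_map_prod_eq_prod_map_map (hA.prodMk hB).aemeasurable hC.aemeasurable,
    hAB.map_prod_eq_prod_map_map hA.aemeasurable hB.aemeasurable]
  have h1 := h.map_prod_eq_prod_map_map hA.aemeasurable (hB.prodMk hC).aemeasurable
  rw [hBC.map_prod_eq_prod_map_map hB.aemeasurable hC.aemeasurable, ← Measure.prodAssoc_prod] at h1
  have h2 : (fun ω => (A ω, B ω, C ω)) =
      MeasurableEquiv.prodAssoc ∘ (fun ω => ((A ω, B ω), C ω)) := rfl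
  rw [h2, ← Measure.map_map MeasurableEquiv.prodAssoc.measurable ((hA.prodMk hB).prodMk hC)] at h1
  have h3 := congrArg (Measure.map MeasurableEquiv.prodAssoc.symm) h1
  simpa only [MeasurableEquiv.map_symm_map] using h3

/-- A sample independent of a σ-algebra can be integrated out first. -/
lemma setLIntegral_of_indep {Ω α β : Type*} {m mΩ : MeasurableSpace Ω} {μ : Measure Ω}
    [IsProbabilityMeasure μ] [MeasurableSpace α] [MeasurableSpace β] (hm : m ≤ mΩ)
    {x : Ω → α} {w : Ω → β} (hx : Measurable[m] x) (hw : Measurable w)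
    (hind : Indep m (MeasurableSpace.comap w inferInstance) μ) {Φ : α × β → ENNReal}
    (hΦ : Measurable Φ) {A : Set Ω} (hA : MeasurableSet[m] A) :
    ∫⁻ ω in A, Φ (x ω, w ω) ∂μ = ∫⁻ ω in A, ∫⁻ b, Φ (x ω, b) ∂(μ.map w) ∂μ := by
  have hY : Measurable[m] (fun ω => (x ω, A.indicator (1 : Ω → ENNReal) ω)) :=
    hx.prodMk (Measurable.indicator (f := fun _ => (1 : ENNReal)) measurable_const hA)
  have hY' := hY.mono hm le_rfl
  have hYw : IndepFun (fun ω => (x ω, A.indicator (1 : Ω → ENNReal) ω)) w μ :=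
    indep_of_indep_of_le_left hind hY.comap_le
  have hprob : IsProbabilityMeasure (μ.map w) := Measure.isProbabilityMeasure_map hw.aemeasurable
  have hΨ : Measurable (fun q : (α × ENNReal) × β => q.1.2 * Φ (q.1.1, q.2)) :=
    (measurable_snd.comp measurable_fst).mul
      (hΦ.comp ((measurable_fst.comp measurable_fst).prodMk measurable_snd))
  have hlaw := hYw.map_prod_eq_prod_map_map hY'.aemeasurable hw.aemeasurable
  have e1 := lintegral_map (μ := μ) hΨ (hY'.prodMk hw)
  rw [hlaw, lintegral_prod _ hΨ.aemeasurable, lintegral_map hΨ.lintegral_prod_right' hY'] at e1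
  have hind2 : ∀ (u : Ω → ENNReal), ∫⁻ ω in A, u ω ∂μ =
      ∫⁻ ω, A.indicator (1 : Ω → ENNReal) ω * u ω ∂μ := by
    intro u
    rw [← lintegral_indicator (hm _ hA)]
    refine lintegral_congr fun ω => ?_
    by_cases h : ω ∈ A <;> simp [h]
  rw [hind2, hind2, ← e1]
  refine lintegral_congr fun ω => ?_
  exact lintegral_const_mul _ (hΦ.comp measurable_prodMk_left)

section

variable {n : ℕ} {Ω S : Type*} [MeasurableSpace Ω] [MeasurableSpace S] {μ : Measure Ω}
  {P : Measure S} {H : EuclideanSpace ℝ (Fin n) → S → ℝ} {X : Set (EuclideanSpace ℝ (Fin n))}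
  {γ η : ℕ → ℝ} {V : ℕ → Ω → ℝ} {Z : ℕ → Ω → EuclideanSpace ℝ (Fin n)} {s : ℕ → Ω → S}
  {x : ℕ → Ω → EuclideanSpace ℝ (Fin n)}

/-- The starting point and the samples drawn before iteration `k`. -/
def history (V : ℕ → Ω → ℝ) (Z : ℕ → Ω → EuclideanSpace ℝ (Fin n)) (s : ℕ → Ω → S)
    (x : ℕ → Ω → EuclideanSpace ℝ (Fin n)) (k : ℕ) (ω : Ω) :
    EuclideanSpace ℝ (Fin n) × (Finset.range k → ℝ × EuclideanSpace ℝ (Fin n) × S) :=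
  (x 0 ω, fun i => (V i ω, Z i ω, s i ω))

lemma IsZOSGD.measurable_sample (h : IsZOSGD μ P H X γ η V Z s x) (k : ℕ) :
    Measurable (fun ω => (V k ω, Z k ω, s k ω)) :=
  (h.measurable_V k).prodMk ((h.measurable_Z k).prodMk (h.measurable_s k))

lemma IsZOSGD.measurable_history (h : IsZOSGD μ P H X γ η V Z s x) (k : ℕ) :
    Measurable (history V Z s x k) :=
  h.measurable_init.prodMk (measurable_pi_lambda _ fun i => h.measurable_sample i)

/-- The filtration generated by the histories. -/
def historyFiltration (h : IsZOSGD μ P H X γ η V Z s x) :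
    Filtration ℕ (inferInstance : MeasurableSpace Ω) where
  seq k := MeasurableSpace.comap (history V Z s x k) inferInstance
  mono' k l hkl := by
    have hr : Measurable (fun q : EuclideanSpace ℝ (Fin n) ×
        (Finset.range l → ℝ × EuclideanSpace ℝ (Fin n) × S) =>
        (q.1, fun i : Finset.range k => q.2 ⟨i, Finset.range_subset_range.2 hkl i.2⟩)) :=
      measurable_fst.prodMk (measurable_pi_lambda _ fun i =>
        (measurable_pi_apply _).comp measurable_snd)
    exact (hr.comp (comap_measurable (history V Z s x l))).comap_le
  le' k := (h.measurable_history k).comap_le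

lemma IsZOSGD.mem (h : IsZOSGD μ P H X γ η V Z s x) (k : ℕ) (ω : Ω) : x k ω ∈ X := by
  cases k with
  | zero => exact h.init_mem ω
  | succ k => exact (h.step k ω).1

lemma IsZOSGD.indep_history [IsProbabilityMeasure μ] (h : IsZOSGD μ P H X γ η V Z s x) (k : ℕ) :
    Indep (historyFiltration h k)
      (MeasurableSpace.comap (fun ω => (V k ω, Z k ω, s k ω)) inferInstance) μ := by
  have hB : Measurable (fun ω (i : Finset.range k) => (V i ω, Z i ω, s i ω)) :=
    measurable_pi_lambda _ fun i => h.measurable_sample i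
  refine indepFun_prodMk_of_indepFun h.measurable_init hB (h.measurable_sample k) ?_ ?_
  · have hψ : Measurable (fun q : ℕ → ℝ × EuclideanSpace ℝ (Fin n) × S =>
        ((fun i : Finset.range k => q i), q k)) :=
      (measurable_pi_lambda _ fun i => measurable_pi_apply i.1).prodMk (measurable_pi_apply k)
    exact h.indep_init.comp measurable_id hψ
  · have h1 := h.indep_sample.indepFun_finset (Finset.range k) {k}
      (Finset.disjoint_singleton_right.2 Finset.notMem_range_self) h.measurable_sample
    exact h1.comp measurable_id
      (measurable_pi_apply (⟨k, Finset.mem_singleton_self k⟩ : ({k} : Finset ℕ)))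

lemma IsZOSGD.adapted (h : IsZOSGD μ P H X γ η V Z s x) (hX : Convex ℝ X) (hXc : IsClosed X)
    (hne : X.Nonempty) (hH : Measurable (Function.uncurry H)) (k : ℕ) :
    Measurable[historyFiltration h k] (x k) := by
  obtain ⟨π, hπm, hπ⟩ := exists_measurable_projection hX hXc hne
  induction k with
  | zero => exact measurable_fst.comp (comap_measurable (history V Z s x 0))
  | succ k ih =>
    have h1 : Measurable[historyFiltration h (k + 1)] (x k) :=
      ih.mono ((historyFiltration h).mono k.le_succ) le_rfl
    have h2 : Measurable[historyFiltration h (k + 1)] (fun ω => (V k ω, Z k ω, s k ω)) :=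
      ((measurable_pi_apply (⟨k, Finset.self_mem_range_succ k⟩ : Finset.range (k + 1))).comp
        measurable_snd).comp (comap_measurable (history V Z s x (k + 1)))
    have h3 : x (k + 1) = fun ω => π (x k ω - γ k •
        estimator H (η k) (x k ω) (V k ω) (Z k ω) (s k ω)) := funext fun ω => hπ _ _ (h.step k ω)
    rw [h3]
    exact hπm.comp (h1.sub (((measurable_estimator hH (η k)).comp (h1.prodMk h2)).const_smul (γ k)))

/-! ### Convergence for a Lipschitz integrand -/

/-- The one-step inequality for the iterates, in the form required by the Robbins-Siegmund theorem:
the current sample is integrated out with the iterate frozen, and the projection does not increase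
the distance to `y`. -/
lemma IsZOSGD.step_le [IsProbabilityMeasure μ] [IsProbabilityMeasure P]
    (h : IsZOSGD μ P H X γ η V Z s x)
    {f : EuclideanSpace ℝ (Fin n) → ℝ} {L : NNReal} (hH : LipschitzIntegrand P H f L)
    (hX : Convex ℝ X) (hXc : IsClosed X) (hγ : ∀ k, 0 < γ k) (hη : ∀ k, 0 < η k)
    {y : EuclideanSpace ℝ (Fin n)} (hy : y ∈ optimalSet X f) (k : ℕ) {A : Set Ω}
    (hA : MeasurableSet[historyFiltration h k] A) :
    ∫⁻ ω in A, ENNReal.ofReal (‖x (k + 1) ω - y‖ ^ 2) ∂μ +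
        ∫⁻ ω in A, ENNReal.ofReal (2 * γ k * (f (x k ω) - f y)) ∂μ ≤
      ∫⁻ ω in A, ENNReal.ofReal (‖x k ω - y‖ ^ 2) ∂μ + ENNReal.ofReal
        (γ k * η k * (4 * L * ∫ z, ‖z‖ ∂(stdGaussian (EuclideanSpace ℝ (Fin n)))) +
          γ k ^ 2 * (n * (4 / Real.pi * L ^ 2))) * μ A := by
  have hx := h.adapted hX hXc ⟨y, hy.1⟩ hH.measurable k
  have hx' : Measurable (x k) := hx.mono ((historyFiltration h).le k) le_rfl
  have hΦ : Measurable (fun q : EuclideanSpace ℝ (Fin n) × ℝ × EuclideanSpace ℝ (Fin n) × S =>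
      ENNReal.ofReal (‖q.1 - γ k • estimator H (η k) q.1 q.2.1 q.2.2.1 q.2.2.2 - y‖ ^ 2)) :=
    (((measurable_fst.sub ((measurable_estimator hH.measurable (η k)).const_smul
      (γ k))).sub_const y).norm.pow_const 2).ennreal_ofReal
  have h1 : ∫⁻ ω in A, ENNReal.ofReal (‖x (k + 1) ω - y‖ ^ 2) ∂μ ≤
      ∫⁻ ω in A, ∫⁻ w, ENNReal.ofReal (‖x k ω - γ k • estimator H (η k) (x k ω) w.1 w.2.1 w.2.2
        - y‖ ^ 2) ∂(sampleLaw n P (η k)) ∂μ := by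
    have h2 := setLIntegral_of_indep ((historyFiltration h).le k) hx (h.measurable_sample k)
      (h.indep_history k) hΦ hA
    rw [h.law_sample k] at h2
    refine le_trans (lintegral_mono fun ω => ENNReal.ofReal_le_ofReal ?_) h2.le
    exact pow_le_pow_left₀ (norm_nonneg _)
      ((h.step k ω).norm_sub_le hX (isProjection_self hy.1)) 2
  have hTm : Measurable (fun ω => ENNReal.ofReal (2 * γ k * (f (x k ω) - f y))) :=
    (((hH.lipschitzWith.continuous.measurable.comp hx').sub_const _).const_mul _).ennreal_ofReal
  have hYm : Measurable (fun ω => ENNReal.ofReal (‖x k ω - y‖ ^ 2)) :=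
    ((hx'.sub_const y).norm.pow_const 2).ennreal_ofReal
  refine (add_le_add_left h1 _).trans ?_
  rw [← lintegral_add_right _ hTm, ← setLIntegral_const, ← lintegral_add_left hYm]
  exact lintegral_mono fun ω => hH.descent (hη k) (hγ k) (hy.2 _ (h.mem k ω))

/-- The squared distance to every optimal solution is an almost supermartingale, and the weighted
optimality gaps are summable; applied to a countable dense set of optimal solutions this gives the
convergence of the iterates. -/
theorem IsZOSGD.convergesAS [IsProbabilityMeasure μ] [IsProbabilityMeasure P]
    (h : IsZOSGD μ P H X γ η V Z s x)
    {f : EuclideanSpace ℝ (Fin n) → ℝ} {L : NNReal} (hH : LipschitzIntegrand P H f L)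
    (hX : Convex ℝ X) (hXc : IsClosed X) (hstep : StepAssumption γ η)
    (hne : (optimalSet X f).Nonempty) : ConvergesAS μ x (optimalSet X f) := by
  obtain ⟨D, hDs, hDcount, hDc⟩ :=
    (TopologicalSpace.IsSeparable.of_separableSpace (optimalSet X f)).exists_countable_dense_subset
  have hfc := hH.lipschitzWith.continuous
  have hC0 : 0 ≤ ∫ z, ‖z‖ ∂(stdGaussian (EuclideanSpace ℝ (Fin n))) :=
    integral_nonneg fun _ => norm_nonneg _
  have hae : ∀ d ∈ D, ∀ᵐ ω ∂μ, (∃ a, Tendsto (fun k => ‖x k ω - d‖ ^ 2) atTop (𝓝 a)) ∧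
      Summable (fun k => 2 * γ k * (f (x k ω) - f d)) := by
    intro d hd
    have hxm := h.adapted hX hXc ⟨d, (hDs hd).1⟩ hH.measurable
    refine almost_supermartingale (ℱ := historyFiltration h) (fun k ω => sq_nonneg _)
      (fun k ω => mul_nonneg (mul_nonneg zero_le_two (hstep.γ_pos k).le)
        (sub_nonneg.2 ((hDs hd).2 _ (h.mem k ω)))) (fun k => ?_)
      ((hstep.sum_γ_η.mul_right _).add (hstep.sum_γ_sq.mul_right _))
      (fun k => (by fun_prop : Measurable fun p : EuclideanSpace ℝ (Fin n) =>
        ‖p - d‖ ^ 2).comp (hxm k))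
      (fun k => ((hfc.measurable.sub_const (f d)).const_mul (2 * γ k)).comp (hxm k))
      (fun k A hA => h.step_le hH hX hXc hstep.γ_pos hstep.η_pos (hDs hd) k hA)
    have := hstep.γ_pos k
    have := hstep.η_pos k
    positivity
  obtain ⟨d, hd⟩ : D.Nonempty := by
    obtain ⟨p, hp⟩ := hne
    exact closure_nonempty_iff.1 ⟨p, hDc hp⟩
  filter_upwards [(ae_ball_iff hDcount).2 hae] with ω hω
  refine exists_tendsto_optimalSet hXc hfc hDs hDc (fun k => h.mem k ω) hd hstep.γ_pos hstep.sum_γ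
    (fun d hd => (hω d hd).1) (((hω d hd).2.mul_left (1 / 2)).congr fun k => ?_)
  ring

end

/-! ### The standard setting and the random field setting -/

lemma ofReal_mul_norm_le (L r : ℝ) (hr : 0 ≤ r) :
    ENNReal.ofReal (L * r) ≤ ENNReal.ofReal (L.toNNReal * r) :=
  ENNReal.ofReal_le_ofReal (mul_le_mul_of_nonneg_right (Real.le_coe_toNNReal L) hr)

lemma StandardAssumption.lipschitzIntegrand {n : ℕ} {Ξ : Type*} [MeasurableSpace Ξ] {P : Measure Ξ}
    {F : EuclideanSpace ℝ (Fin n) → Ξ → ℝ} {L₀ : ℝ} (h : StandardAssumption P F L₀) :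
    LipschitzIntegrand P F (objective P F) L₀.toNNReal where
  measurable := measurable_uncurry_of_continuous_of_measurable
    (fun ξ => (h.convex ξ).locallyLipschitz.continuous) h.measurable
  integrable := h.integrable
  integral_eq _ := rfl
  lipschitz x y := (h.lipschitz x y).trans (ofReal_mul_norm_le _ _ (norm_nonneg _))
  convex := by
    refine ⟨convex_univ, fun x _ y _ a b ha hb hab => ?_⟩
    simp only [objective, smul_eq_mul]
    rw [← integral_const_mul, ← integral_const_mul,
      ← integral_add ((h.integrable x).const_mul a) ((h.integrable y).const_mul b)]
    exact integral_mono (h.integrable _)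
      (((h.integrable x).const_mul a).add ((h.integrable y).const_mul b))
      fun ξ => (h.convex ξ).2 (Set.mem_univ x) (Set.mem_univ y) ha hb hab

lemma RandomFieldAssumption.lipschitzIntegrand {n : ℕ} {Ξ S : Type*} [MeasurableSpace Ξ]
    [MeasurableSpace S] {P : Measure S} {field : EuclideanSpace ℝ (Fin n) → S → Ξ}
    {D : EuclideanSpace ℝ (Fin n) → Measure Ξ} {Fhat : EuclideanSpace ℝ (Fin n) → Ξ → ℝ} {L₀ : ℝ}
    (h : RandomFieldAssumption P field D Fhat L₀) :
    LipschitzIntegrand P (fun y t => Fhat y (field y t)) (ddObjective D Fhat) L₀.toNNReal := by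
  have hfm : ∀ x, Measurable (field x) := fun x => h.measurable_field.comp measurable_prodMk_left
  have hFm : ∀ x, Measurable (Fhat x) := fun x => h.measurable_Fhat.comp measurable_prodMk_left
  refine ⟨h.measurable_Fhat.comp (measurable_fst.prodMk h.measurable_field), fun x => ?_,
    fun x => ?_, fun x y => (h.lipschitz x y).trans (ofReal_mul_norm_le _ _ (norm_nonneg _)),
    h.convex⟩
  · have h1 := h.integrable x
    rw [← h.marginal x] at h1
    exact h1.comp_measurable (hfm x)
  · rw [ddObjective, ← h.marginal x,
      integral_map (hfm x).aemeasurable (hFm x).aestronglyMeasurable]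

/-! ### The known density setting -/

/-- The symmetrized integrand of the Kullback-Leibler divergence is `(a - b) (log a - log b)`; as
`log` has slope at least `1 / (M q)` on `(0, M q]`, it dominates the squared difference. -/
lemma sq_sub_le_klFun {a b q M : ℝ} (ha : 0 < a) (hb : 0 < b) (hq : 0 < q) (haM : a ≤ M * q)
    (hbM : b ≤ M * q) :
    q * (a / q - b / q) ^ 2 ≤
      M * (b * InformationTheory.klFun (a / b) + a * InformationTheory.klFun (b / a)) := by
  have key : ∀ {a b : ℝ}, 0 < a → 0 < b → a ≤ M * q → b ≤ a →
      (a - b) ^ 2 ≤ M * q * ((a - b) * (Real.log a - Real.log b)) := by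
    intro a b ha hb haM hba
    have h1 := Real.one_sub_inv_le_log_of_pos (div_pos ha hb)
    rw [Real.log_div ha.ne' hb.ne', inv_div] at h1
    have h2 : (a - b) ≤ a * (Real.log a - Real.log b) := by
      calc a - b = a * (1 - b / a) := by field_simp
        _ ≤ _ := mul_le_mul_of_nonneg_left h1 ha.le
    have h3 : 0 ≤ Real.log a - Real.log b := sub_nonneg.2 (Real.log_le_log hb hba)
    calc (a - b) ^ 2 = (a - b) * (a - b) := sq _
      _ ≤ (a - b) * (M * q * (Real.log a - Real.log b)) :=
          mul_le_mul_of_nonneg_left (h2.trans (mul_le_mul_of_nonneg_right haM h3))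
            (sub_nonneg.2 hba)
      _ = _ := by ring
  have hlog : (a - b) ^ 2 ≤ M * q * ((a - b) * (Real.log a - Real.log b)) := by
    rcases le_total b a with h | h
    · exact key ha hb haM h
    · have := key hb ha hbM h
      linarith
  have hsum : b * InformationTheory.klFun (a / b) + a * InformationTheory.klFun (b / a) =
      (a - b) * (Real.log a - Real.log b) := by
    simp only [InformationTheory.klFun, Real.log_div ha.ne' hb.ne', Real.log_div hb.ne' ha.ne']
    field_simp
    ring
  rw [hsum, ← sub_div, div_pow]
  have h4 : q * ((a - b) ^ 2 / q ^ 2) = (a - b) ^ 2 / q := by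
    field_simp
  rw [h4, div_le_iff₀ hq]
  linarith

section

variable {Ξ : Type*} [MeasurableSpace Ξ] {ν : Measure Ξ}

lemma IsDensity.isProbabilityMeasure {q : Ξ → ℝ} (h : IsDensity ν q) :
    IsProbabilityMeasure (densityLaw ν q) :=
  ⟨by rw [densityLaw, withDensity_apply _ MeasurableSet.univ, Measure.restrict_univ,
    h.integral_eq_one]⟩

lemma ae_eq_zero_of_densityLaw_ac {q₁ q₂ : Ξ → ℝ} (h₁ : IsDensity ν q₁) (h₂ : IsDensity ν q₂)
    (hac : densityLaw ν q₁ ≪ densityLaw ν q₂) : ∀ᵐ ξ ∂ν, q₂ ξ = 0 → q₁ ξ = 0 := by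
  have hm₂ : MeasurableSet {ξ | q₂ ξ = 0} := h₂.measurable (measurableSet_singleton 0)
  have h0 : densityLaw ν q₂ {ξ | q₂ ξ = 0} = 0 := by
    rw [densityLaw, withDensity_apply_eq_zero h₂.measurable.ennreal_ofReal]
    refine measure_mono_null (fun ξ hξ => ?_) (measure_empty (μ := ν))
    obtain ⟨hξ1, hξ2⟩ := hξ
    have hξ2' : q₂ ξ = 0 := hξ2
    exact hξ1 (by simp [hξ2'])
  have h1 := hac h0
  rw [densityLaw, withDensity_apply_eq_zero h₁.measurable.ennreal_ofReal] at h1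
  rw [ae_iff]
  refine measure_mono_null (fun ξ hξ => ?_) h1
  obtain ⟨hξ1, hξ2⟩ : q₂ ξ = 0 ∧ ¬ q₁ ξ = 0 := by simpa using hξ
  refine ⟨?_, hξ1⟩
  have : 0 < q₁ ξ := lt_of_le_of_ne (h₁.nonneg ξ) (Ne.symm hξ2)
  simpa using this

lemma klDiv_densityLaw {q₁ q₂ : Ξ → ℝ} (h₁ : IsDensity ν q₁) (h₂ : IsDensity ν q₂)
    (hac : densityLaw ν q₁ ≪ densityLaw ν q₂) :
    InformationTheory.klDiv (densityLaw ν q₁) (densityLaw ν q₂) =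
      ∫⁻ ξ, ENNReal.ofReal (q₂ ξ * InformationTheory.klFun (q₁ ξ / q₂ ξ)) ∂ν := by
  have := h₁.isProbabilityMeasure
  have := h₂.isProbabilityMeasure
  have hrm : Measurable (fun ξ => ENNReal.ofReal (q₁ ξ / q₂ ξ)) :=
    (h₁.measurable.div h₂.measurable).ennreal_ofReal
  have heq : densityLaw ν q₁ =
      (densityLaw ν q₂).withDensity (fun ξ => ENNReal.ofReal (q₁ ξ / q₂ ξ)) := by
    rw [densityLaw, densityLaw, ← withDensity_mul _ h₂.measurable.ennreal_ofReal hrm]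
    refine withDensity_congr_ae ?_
    filter_upwards [ae_eq_zero_of_densityLaw_ac h₁ h₂ hac] with ξ hξ
    rw [Pi.mul_apply, ← ENNReal.ofReal_mul (h₂.nonneg ξ)]
    by_cases h0 : q₂ ξ = 0
    · rw [hξ h0, h0]
      simp
    · rw [mul_div_cancel₀ _ h0]
  have hrn : (densityLaw ν q₁).rnDeriv (densityLaw ν q₂) =ᵐ[densityLaw ν q₂]
      fun ξ => ENNReal.ofReal (q₁ ξ / q₂ ξ) := by
    rw [heq]
    exact Measure.rnDeriv_withDensity _ hrm
  rw [InformationTheory.klDiv_eq_lintegral_klFun_of_ac hac]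
  have h3 : ∀ᵐ ξ ∂(densityLaw ν q₂), ENNReal.ofReal (InformationTheory.klFun
      ((densityLaw ν q₁).rnDeriv (densityLaw ν q₂) ξ).toReal) =
      ENNReal.ofReal (InformationTheory.klFun (q₁ ξ / q₂ ξ)) := by
    filter_upwards [hrn] with ξ hξ
    rw [hξ, ENNReal.toReal_ofReal (div_nonneg (h₁.nonneg ξ) (h₂.nonneg ξ))]
  have hkm : Measurable (fun ξ => ENNReal.ofReal (InformationTheory.klFun (q₁ ξ / q₂ ξ))) :=
    (InformationTheory.measurable_klFun.comp (h₁.measurable.div h₂.measurable)).ennreal_ofReal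
  rw [lintegral_congr_ae h3, densityLaw,
    lintegral_withDensity_eq_lintegral_mul _ h₂.measurable.ennreal_ofReal hkm]
  refine lintegral_congr fun ξ => ?_
  rw [Pi.mul_apply, ENNReal.ofReal_mul (h₂.nonneg ξ)]

/-- The Kullback-Leibler divergence controls the `L²` distance of bounded likelihood ratios. -/
lemma lintegral_ratio_sub_sq_le {q₁ q₂ q : Ξ → ℝ} (h₁ : IsDensity ν q₁) (h₂ : IsDensity ν q₂)
    (h : IsDensity ν q) {M : ℝ} (hM : 0 ≤ M) (hM₁ : ∀ ξ, q₁ ξ ≤ M * q ξ)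
    (hM₂ : ∀ ξ, q₂ ξ ≤ M * q ξ) (hfin : symKL (densityLaw ν q₁) (densityLaw ν q₂) ≠ ⊤) :
    ∫⁻ ξ, ‖q₁ ξ / q ξ - q₂ ξ / q ξ‖ₑ ^ 2 ∂(densityLaw ν q) ≤
      ENNReal.ofReal M * symKL (densityLaw ν q₁) (densityLaw ν q₂) := by
  obtain ⟨hf1, hf2⟩ := ENNReal.add_ne_top.1 hfin
  have hac1 := (InformationTheory.klDiv_ne_top_iff.1 hf1).1
  have hac2 := (InformationTheory.klDiv_ne_top_iff.1 hf2).1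
  have hk : ∀ {u v : Ξ → ℝ}, IsDensity ν u → IsDensity ν v → Measurable
      (fun ξ => ENNReal.ofReal (v ξ * InformationTheory.klFun (u ξ / v ξ))) := fun hu hv =>
    (hv.measurable.mul (InformationTheory.measurable_klFun.comp
      (hu.measurable.div hv.measurable))).ennreal_ofReal
  have hm : Measurable (fun ξ => ‖q₁ ξ / q ξ - q₂ ξ / q ξ‖ₑ ^ 2) :=
    ((h₁.measurable.div h.measurable).sub (h₂.measurable.div h.measurable)).enorm.pow_const 2
  rw [symKL, klDiv_densityLaw h₁ h₂ hac1, klDiv_densityLaw h₂ h₁ hac2,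
    ← lintegral_add_left (hk h₁ h₂), ← lintegral_const_mul' _ _ ENNReal.ofReal_ne_top,
    densityLaw, lintegral_withDensity_eq_lintegral_mul _ h.measurable.ennreal_ofReal hm]
  refine lintegral_mono_ae ?_
  filter_upwards [ae_eq_zero_of_densityLaw_ac h₁ h₂ hac1, ae_eq_zero_of_densityLaw_ac h₂ h₁ hac2]
    with ξ hξ1 hξ2
  rw [Pi.mul_apply]
  by_cases h0 : q₁ ξ = 0
  · simp [h0, hξ2 h0]
  · have ha : 0 < q₁ ξ := lt_of_le_of_ne (h₁.nonneg ξ) (Ne.symm h0)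
    have hb : 0 < q₂ ξ := lt_of_le_of_ne (h₂.nonneg ξ) (Ne.symm fun h => h0 (hξ1 h))
    have hq : 0 < q ξ := by
      refine lt_of_le_of_ne (h.nonneg ξ) fun hq0 => ?_
      have := hM₁ ξ
      rw [← hq0, mul_zero] at this
      linarith
    rw [← ofReal_norm, ← ENNReal.ofReal_pow (norm_nonneg _), Real.norm_eq_abs, sq_abs,
      ← ENNReal.ofReal_mul hq.le, ← ENNReal.ofReal_add
        (mul_nonneg hb.le (InformationTheory.klFun_nonneg (div_pos ha hb).le))
        (mul_nonneg ha.le (InformationTheory.klFun_nonneg (div_pos hb ha).le)),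
      ← ENNReal.ofReal_mul hM]
    exact ENNReal.ofReal_le_ofReal (sq_sub_le_klFun ha hb hq (hM₁ ξ) (hM₂ ξ))

end

lemma KnownDensityAssumption.lipschitzIntegrand {n : ℕ} {Ξ : Type*} [MeasurableSpace Ξ]
    {ν : Measure Ξ} {supp : EuclideanSpace ℝ (Fin n) → Set Ξ}
    {Fhat p : EuclideanSpace ℝ (Fin n) → Ξ → ℝ} {pt : Ξ → ℝ} {Lξ M Lf Mf : ℝ}
    (h : KnownDensityAssumption ν supp Fhat p pt Lξ M Lf Mf) :
    LipschitzIntegrand (densityLaw ν pt) (reweighted Fhat p pt)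
      (ddObjective (fun x => densityLaw ν (p x)) Fhat)
      (|M| * |Lf| + |Mf| * (√|M| * |Lξ|)).toNNReal := by
  have hprob := h.density_pt.isProbabilityMeasure
  have hFm : ∀ x, Measurable (Fhat x) := fun x => h.measurable_Fhat.comp measurable_prodMk_left
  have hm : Measurable (Function.uncurry (reweighted Fhat p pt)) :=
    h.measurable_Fhat.mul (h.measurable_p.div (h.density_pt.measurable.comp measurable_snd))
  have hac : densityLaw ν pt ≪ ν := withDensity_absolutelyContinuous _ _
  have hr0 : ∀ x ξ, 0 ≤ p x ξ / pt ξ := fun x ξ =>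
    div_nonneg ((h.density_p x).nonneg ξ) (h.density_pt.nonneg ξ)
  have hrM : ∀ x ξ, p x ξ / pt ξ ≤ |M| := fun x ξ => by
    by_cases hξ : ξ ∈ supp x
    · exact (h.ratio_le x ξ hξ).trans (le_abs_self M)
    · rw [h.p_zero x ξ hξ, zero_div]
      exact abs_nonneg M
  have hpM : ∀ x ξ, p x ξ ≤ |M| * pt ξ := fun x ξ => by
    by_cases hξ : ξ ∈ supp x
    · exact (div_le_iff₀ (h.pt_pos x ξ hξ)).1 (hrM x ξ)
    · rw [h.p_zero x ξ hξ]
      exact mul_nonneg (abs_nonneg M) (h.density_pt.nonneg ξ)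
  have hFb : ∀ x, ∀ᵐ ξ ∂ν, ξ ∈ supp x → |Fhat x ξ| ≤ |Mf| := fun x =>
    (h.bounded x).mono fun ξ hξ hs => (hξ hs).trans (le_abs_self Mf)
  refine ⟨hm, fun x => ?_, fun x => ?_, fun x y => ?_, h.convex⟩
  · refine Integrable.of_bound (hm.comp measurable_prodMk_left).aestronglyMeasurable
      (|Mf| * |M|) (hac.ae_le ?_)
    filter_upwards [hFb x] with ξ hξ
    rw [reweighted, norm_mul, Real.norm_eq_abs, Real.norm_of_nonneg (hr0 x ξ)]
    by_cases hs : ξ ∈ supp x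
    · exact mul_le_mul (hξ hs) (hrM x ξ) (hr0 x ξ) (abs_nonneg _)
    · rw [h.p_zero x ξ hs, zero_div, mul_zero]
      positivity
  · simp only [ddObjective, densityLaw]
    rw [integral_withDensity_eq_integral_toReal_smul h.density_pt.measurable.ennreal_ofReal
      (Eventually.of_forall fun _ => ENNReal.ofReal_lt_top),
      integral_withDensity_eq_integral_toReal_smul (h.density_p x).measurable.ennreal_ofReal
      (Eventually.of_forall fun _ => ENNReal.ofReal_lt_top)]
    refine integral_congr_ae (Eventually.of_forall fun ξ => ?_)
    simp only [ENNReal.toReal_ofReal (h.density_pt.nonneg ξ),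
      ENNReal.toReal_ofReal ((h.density_p x).nonneg ξ), smul_eq_mul, reweighted]
    by_cases hs : ξ ∈ supp x
    · have := (h.pt_pos x ξ hs).ne'
      field_simp
    · rw [h.p_zero x ξ hs]
      simp
  · have hfin : symKL (densityLaw ν (p x)) (densityLaw ν (p y)) ≠ ⊤ :=
      ((h.symKL_le x y).trans_lt ENNReal.ofReal_lt_top).ne
    have hsupp : ∀ᵐ ξ ∂ν, ξ ∈ supp x ↔ ξ ∈ supp y := by
      obtain ⟨hf1, hf2⟩ := ENNReal.add_ne_top.1 hfin
      have hiff : ∀ x ξ, ξ ∉ supp x ↔ p x ξ = 0 := fun x ξ =>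
        ⟨h.p_zero x ξ, fun h0 hs => (h.p_pos x ξ hs).ne' h0⟩
      filter_upwards [ae_eq_zero_of_densityLaw_ac (h.density_p x) (h.density_p y)
        (InformationTheory.klDiv_ne_top_iff.1 hf1).1, ae_eq_zero_of_densityLaw_ac (h.density_p y)
        (h.density_p x) (InformationTheory.klDiv_ne_top_iff.1 hf2).1] with ξ h1 h2
      rw [← not_iff_not, hiff, hiff]
      exact ⟨h2, h1⟩
    have hratio : eLpNorm (fun ξ => p x ξ / pt ξ - p y ξ / pt ξ) 2 (densityLaw ν pt) ≤
        ENNReal.ofReal (√|M| * |Lξ| * ‖x - y‖) := by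
      have h1 := (lintegral_ratio_sub_sq_le (h.density_p x) (h.density_p y) h.density_pt
        (abs_nonneg M) (hpM x) (hpM y) hfin).trans (mul_le_mul_right (h.symKL_le x y) _)
      have h2 := eLpNorm_nnreal_pow_eq_lintegral (f := fun ξ => p x ξ / pt ξ - p y ξ / pt ξ)
        (μ := densityLaw ν pt) (p := 2) two_ne_zero
      simp only [NNReal.coe_ofNat, ENNReal.rpow_ofNat, ENNReal.coe_ofNat] at h2
      rw [← h2, ← ENNReal.ofReal_mul (abs_nonneg M)] at h1
      have h3 : |M| * (Lξ ^ 2 * ‖x - y‖ ^ 2) = (√|M| * |Lξ| * ‖x - y‖) ^ 2 := by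
        rw [mul_pow, mul_pow, Real.sq_sqrt (abs_nonneg M), sq_abs, mul_assoc]
      rw [h3, ENNReal.ofReal_pow (by positivity)] at h1
      exact (ENNReal.pow_le_pow_left_iff two_ne_zero).1 h1
    have hrm : ∀ x, Measurable (fun ξ => p x ξ / pt ξ) := fun x =>
      (h.density_p x).measurable.div h.density_pt.measurable
    have hbound : ∀ᵐ ξ ∂(densityLaw ν pt),
        ‖reweighted Fhat p pt x ξ - reweighted Fhat p pt y ξ‖ ≤
        |M| * ‖Fhat x ξ - Fhat y ξ‖ + |Mf| * ‖p x ξ / pt ξ - p y ξ / pt ξ‖ := by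
      refine hac.ae_le ?_
      filter_upwards [hsupp, hFb y] with ξ hs hF
      by_cases hξ : ξ ∈ supp x
      · have h1 : reweighted Fhat p pt x ξ - reweighted Fhat p pt y ξ =
            p x ξ / pt ξ * (Fhat x ξ - Fhat y ξ) +
              Fhat y ξ * (p x ξ / pt ξ - p y ξ / pt ξ) := by
          simp only [reweighted]
          ring
        rw [h1]
        refine (norm_add_le _ _).trans (add_le_add ?_ ?_)
        · rw [norm_mul, Real.norm_of_nonneg (hr0 x ξ)]
          exact mul_le_mul_of_nonneg_right (hrM x ξ) (norm_nonneg _)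
        · rw [norm_mul]
          exact mul_le_mul_of_nonneg_right (hF (hs.1 hξ)) (norm_nonneg _)
      · have hξy : ξ ∉ supp y := fun hy => hξ (hs.2 hy)
        simp only [reweighted, h.p_zero x ξ hξ, h.p_zero y ξ hξy, zero_div, mul_zero, sub_zero,
          norm_zero]
        positivity
    calc eLpNorm (fun ξ => reweighted Fhat p pt x ξ - reweighted Fhat p pt y ξ) 2 (densityLaw ν pt)
        ≤ eLpNorm (fun ξ => |M| * ‖Fhat x ξ - Fhat y ξ‖ +
            |Mf| * ‖p x ξ / pt ξ - p y ξ / pt ξ‖) 2 (densityLaw ν pt) := by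
          refine eLpNorm_mono_ae (hbound.mono fun ξ hξ => hξ.trans (le_abs_self _))
      _ ≤ eLpNorm (fun ξ => |M| * ‖Fhat x ξ - Fhat y ξ‖) 2 (densityLaw ν pt) +
            eLpNorm (fun ξ => |Mf| * ‖p x ξ / pt ξ - p y ξ / pt ξ‖) 2 (densityLaw ν pt) :=
          eLpNorm_add_le (((hFm x).sub (hFm y)).norm.const_mul _).aestronglyMeasurable
            (((hrm x).sub (hrm y)).norm.const_mul _).aestronglyMeasurable (by norm_num)
      _ ≤ ENNReal.ofReal |M| * ENNReal.ofReal (|Lf| * ‖x - y‖) +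
            ENNReal.ofReal |Mf| * ENNReal.ofReal (√|M| * |Lξ| * ‖x - y‖) := by
          have hsm : ∀ (c : ℝ) (u : Ξ → ℝ), 0 ≤ c → eLpNorm (fun ξ => c * ‖u ξ‖) 2
              (densityLaw ν pt) = ENNReal.ofReal c * eLpNorm u 2 (densityLaw ν pt) := by
            intro c u hc
            have := eLpNorm_const_smul c (fun ξ => ‖u ξ‖) 2 (densityLaw ν pt)
            rw [eLpNorm_norm, ← ofReal_norm, Real.norm_of_nonneg hc] at this
            exact this
          rw [hsm _ _ (abs_nonneg _), hsm _ _ (abs_nonneg _)]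
          gcongr
          exact (h.lipschitz x y).trans (ENNReal.ofReal_le_ofReal
            (mul_le_mul_of_nonneg_right (le_abs_self Lf) (norm_nonneg _)))
      _ = _ := by
          rw [← ENNReal.ofReal_mul (abs_nonneg _), ← ENNReal.ofReal_mul (abs_nonneg _),
            ← ENNReal.ofReal_add (by positivity) (by positivity),
            Real.coe_toNNReal _ (by positivity)]
          congr 1
          ring

end EsGs

theorem proposition4p1 {n : ℕ} {Ω Ξ S : Type*} [MeasurableSpace Ω] [MeasurableSpace Ξ]
    [MeasurableSpace S] (μ : Measure Ω) [IsProbabilityMeasure μ]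
    (X : Set (EuclideanSpace ℝ (Fin n))) (hX_convex : Convex ℝ X) (hX_closed : IsClosed X)
    (γ η : ℕ → ℝ) (hstep : EsGs.StepAssumption γ η)
    (V : ℕ → Ω → ℝ) (Z : ℕ → Ω → EuclideanSpace ℝ (Fin n))
    (x : ℕ → Ω → EuclideanSpace ℝ (Fin n)) :
    -- the standard setting
    (∀ (P : Measure Ξ) [IsProbabilityMeasure P] (F : EuclideanSpace ℝ (Fin n) → Ξ → ℝ) (L₀ : ℝ)
      (ξ : ℕ → Ω → Ξ),
      EsGs.StandardAssumption P F L₀ →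
      (EsGs.optimalSet X (EsGs.objective P F)).Nonempty →
      EsGs.IsZOSGD μ P F X γ η V Z ξ x →
      EsGs.ConvergesAS μ x (EsGs.optimalSet X (EsGs.objective P F))) ∧
    -- the decision-dependent setting with a known conditional density
    (∀ (ν : Measure Ξ) [SigmaFinite ν] (supp : EuclideanSpace ℝ (Fin n) → Set Ξ)
      (Fhat p : EuclideanSpace ℝ (Fin n) → Ξ → ℝ) (pt : Ξ → ℝ) (Lξ M Lf Mf : ℝ)
      (ξ : ℕ → Ω → Ξ),
      EsGs.KnownDensityAssumption ν supp Fhat p pt Lξ M Lf Mf →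
      (EsGs.optimalSet X
        (EsGs.ddObjective (fun y => EsGs.densityLaw ν (p y)) Fhat)).Nonempty →
      EsGs.IsZOSGD μ (EsGs.densityLaw ν pt) (EsGs.reweighted Fhat p pt) X γ η V Z ξ x →
      EsGs.ConvergesAS μ x (EsGs.optimalSet X
        (EsGs.ddObjective (fun y => EsGs.densityLaw ν (p y)) Fhat))) ∧
    -- the decision-dependent setting with an unknown distribution
    (∀ (P : Measure S) [IsProbabilityMeasure P] (field : EuclideanSpace ℝ (Fin n) → S → Ξ)
      (D : EuclideanSpace ℝ (Fin n) → Measure Ξ) (Fhat : EuclideanSpace ℝ (Fin n) → Ξ → ℝ)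
      (L₀ : ℝ) (s : ℕ → Ω → S),
      EsGs.RandomFieldAssumption P field D Fhat L₀ →
      (EsGs.optimalSet X (EsGs.ddObjective D Fhat)).Nonempty →
      EsGs.IsZOSGD μ P (fun y t => Fhat y (field y t)) X γ η V Z s x →
      EsGs.ConvergesAS μ x (EsGs.optimalSet X (EsGs.ddObjective D Fhat))) := by
  refine ⟨fun P _ F L₀ ξ hF hne hx => ?_, fun ν _ supp Fhat p pt Lξ M Lf Mf ξ hF hne hx => ?_,
    fun P _ field D Fhat L₀ s hF hne hx => ?_⟩
  · exact hx.convergesAS hF.lipschitzIntegrand hX_convex hX_closed hstep hne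
  · have := hF.density_pt.isProbabilityMeasure
    exact hx.convergesAS hF.lipschitzIntegrand hX_convex hX_closed hstep hne
  · exact hx.convergesAS hF.lipschitzIntegrand hX_convex hX_closed hstep hne
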